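/- Let $k$ be a field of characteristic $0$, let $\mathbb{L}(x,y)$ be the free Lie algebra over $k$ on $x,y$, and let $\mathbb{L}^{\ge 3}(x,y)$ be the space of its elements without homogeneous components of degree $<3$. For elements $a,b$ of a Lie algebra, $\varphi(a,b)$ denotes the image of $\varphi\in\mathbb{L}(x,y)$ under the Lie morphism $x\mapsto a$, $y\mapsto b$. *The Lie algebra $\mathfrak{krv}_2^{\mathrm{sym}}$.* A pair $(a,b)\in\mathbb{L}(x,y)^2$ stands for the tangential derivation $u$ of $\mathbb{L}(x,y)$ with $u(x)=[x,a]$, $u(y)=[y,b]$ (it determines $a$ modulo $kx$ and $b$ modulo $ky$). Let $|\cdot|:k\langle x,y\rangle\to|k\langle x,y\rangle|=k\langle x,y\rangle/[k\langle x,y\rangle,k\langle x,y\rangle]$ be the projection to cyclic words, where the denominator is the linear span of the commutators. Every $c\in k\langle x,y\rangle$ is uniquely $c=\varepsilon(c)+x\,d_x(c)+y\,d_y(c)$ with $\varepsilon(c)\in k$, and one puts $\mathrm{div}(a,b)=|x\,d_x(a)+y\,d_y(b)|$. Then $\mathfrak{krv}_2$ is the space of the tangential derivations $u=(a,b)$ with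 $u(-x-y)=0$ and $\mathrm{div}(a,b)=|f_0(x)|+|f_1(y)|+|f_2(-x-y)|$ for some one-variable polynomials $f_0,f_1,f_2$ over $k$, and $\mathfrak{krv}_2^{\mathrm{sym}}\subset\mathfrak{krv}_2$ is the subspace of the elements fixed by the involution $(a(x,y),b(x,y))\mapsto(b(y,x),a(y,x))$, that is, of the $u\in\mathfrak{krv}_2$ that commute with the automorphism $x\leftrightarrow y$. *The map $\mathrm{pent}^1_{krv}$.* Let $\mathfrak{t}_n$ be the Lie algebra over $k$ with generators $t_{ij}$, $1\le i,j\le n$, and relations $t_{ij}=t_{ji}$, $t_{ii}=0$, $[t_{ij},t_{lm}]=0$ and $[t_{ij},t_{il}+t_{jl}]=0$ for distinct indices. Let $\mathrm{pr}^i:\mathfrak{t}_4\to\mathfrak{t}_3$ be the morphism that sends each $t_{ij}$ to $0$ and renumbers the other indices, and put $\mathfrak{brun}_{2,2}=\ker\mathrm{pr}^3\cap\ker\mathrm{pr}^4\subset\mathfrak{t}_4$. For $\varphi\in\mathbb{L}^{\ge 3}(x,y)$ the element $$\mathrm{pent}(\varphi)=\varphi(t_{12},t_{23})+\varphi(t_{12}+t_{13},t_{24}+t_{34})+\varphi(t_{23},t_{34})-\varphi(t_{13}+t_{23},t_{34})-\varphi(t_{12},t_{23}+t_{24})$$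 of $\mathfrak{t}_4$ lies in $\mathfrak{brun}_{2,2}$; let $\mathrm{pent}^1_{krv}(\varphi)$ be its class in $\mathfrak{brun}_{2,2}/[\mathfrak{brun}_{2,2},\mathfrak{brun}_{2,2}]$. **Theorem.** Let $\varphi\in\mathbb{L}^{\ge 3}(x,y)$. The pair $(\varphi(-x-y,x),\varphi(-x-y,y))$ lies in $\mathfrak{krv}_2^{\mathrm{sym}}$ if and only if the following two equations hold: 1. $[x,\varphi(-x-y,x)]+[y,\varphi(-x-y,y)]=0$, 2. $\mathrm{pent}^1_{krv}(\varphi)=0$ in $\mathfrak{brun}_{2,2}/[\mathfrak{brun}_{2,2},\mathfrak{brun}_{2,2}]$. -/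

import Mathlib

namespace KashiwaraVergne

universe u

/-! ## Derivations of a free Lie algebra with prescribed values on the generators -/

section SquareZero

/-- The square-zero extension `L ⊕ εL` of a Lie algebra by its adjoint module: bracket
`⁅a + εb, a' + εb'⁆ = ⁅a, a'⁆ + ε(⁅a, b'⁆ + ⁅b, a'⁆)`. -/
def SqZero (L : Type u) : Type u := L × L

variable {L : Type u} [LieRing L]

instance : AddCommGroup (SqZero L) := inferInstanceAs (AddCommGroup (L × L))

instance : Bracket (SqZero L) (SqZero L) :=
  ⟨fun p q => (⁅p.1, q.1⁆, ⁅p.1, q.2⁆ + ⁅p.2, q.1⁆)⟩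

theorem SqZero.lie_def (p q : SqZero L) :
    ⁅p, q⁆ = ((⁅p.1, q.1⁆, ⁅p.1, q.2⁆ + ⁅p.2, q.1⁆) : L × L) := rfl

theorem SqZero.add_fst (p q : SqZero L) : (p + q).1 = p.1 + q.1 := rfl

theorem SqZero.add_snd (p q : SqZero L) : (p + q).2 = p.2 + q.2 := rfl

instance : LieRing (SqZero L) where
  add_lie p q r := by
    apply Prod.ext
    · change ⁅p.1 + q.1, r.1⁆ = ⁅p.1, r.1⁆ + ⁅q.1, r.1⁆
      exact add_lie _ _ _
    · change ⁅p.1 + q.1, r.2⁆ + ⁅p.2 + q.2, r.1⁆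
        = (⁅p.1, r.2⁆ + ⁅p.2, r.1⁆) + (⁅q.1, r.2⁆ + ⁅q.2, r.1⁆)
      rw [add_lie, add_lie]; abel
  lie_add p q r := by
    apply Prod.ext
    · change ⁅p.1, q.1 + r.1⁆ = ⁅p.1, q.1⁆ + ⁅p.1, r.1⁆
      exact lie_add _ _ _
    · change ⁅p.1, q.2 + r.2⁆ + ⁅p.2, q.1 + r.1⁆
        = (⁅p.1, q.2⁆ + ⁅p.2, q.1⁆) + (⁅p.1, r.2⁆ + ⁅p.2, r.1⁆)
      rw [lie_add, lie_add]; abel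
  lie_self p := by
    apply Prod.ext
    · exact lie_self p.1
    · change ⁅p.1, p.2⁆ + ⁅p.2, p.1⁆ = 0
      rw [← lie_skew p.1 p.2]; abel
  leibniz_lie p q r := by
    apply Prod.ext
    · exact leibniz_lie p.1 q.1 r.1
    · change ⁅p.1, ⁅q.1, r.2⁆ + ⁅q.2, r.1⁆⁆ + ⁅p.2, ⁅q.1, r.1⁆⁆
        = (⁅⁅p.1, q.1⁆, r.2⁆ + ⁅⁅p.1, q.2⁆ + ⁅p.2, q.1⁆, r.1⁆)
          + (⁅q.1, ⁅p.1, r.2⁆ + ⁅p.2, r.1⁆⁆ + ⁅q.2, ⁅p.1, r.1⁆⁆)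
      rw [lie_add, lie_add, add_lie, leibniz_lie p.1 q.1 r.2, leibniz_lie p.1 q.2 r.1,
        leibniz_lie p.2 q.1 r.1]
      abel

variable (k : Type u) [CommRing k] [LieAlgebra k L]

instance : Module k (SqZero L) := inferInstanceAs (Module k (L × L))

instance : LieAlgebra k (SqZero L) where
  lie_smul c p q := by
    apply Prod.ext
    · exact lie_smul c p.1 q.1
    · change ⁅p.1, c • q.2⁆ + ⁅p.2, c • q.1⁆ = c • (⁅p.1, q.2⁆ + ⁅p.2, q.1⁆)
      rw [lie_smul, lie_smul, smul_add]

/-- The element `a + εb`. -/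
def SqZero.mk (a b : L) : SqZero L := (a, b)

/-- The projection `a + εb ↦ a`. -/
def SqZero.fstHom : SqZero L →ₗ⁅k⁆ L where
  toFun p := p.1
  map_add' _ _ := rfl
  map_smul' _ _ := rfl
  map_lie' := rfl

end SquareZero

section Derivations

variable (k : Type u) [Field k]

/-- The free Lie algebra on two generators. -/
abbrev L₂ : Type u := FreeLieAlgebra k (Fin 2)

/-- The first generator. -/
noncomputable def X : L₂ k := FreeLieAlgebra.of k 0

/-- The second generator. -/
noncomputable def Y : L₂ k := FreeLieAlgebra.of k 1

variable {k}

/-- The Lie algebra morphism `z ↦ z + ε u(z)` of the derivation `u` with `u(x_i) = c i`. -/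
noncomputable def derivationHom (c : Fin 2 → L₂ k) : L₂ k →ₗ⁅k⁆ SqZero (L₂ k) :=
  FreeLieAlgebra.lift k (fun i => SqZero.mk (FreeLieAlgebra.of k i) (c i))

theorem derivationHom_of (c : Fin 2 → L₂ k) (i : Fin 2) :
    derivationHom c (FreeLieAlgebra.of k i) = SqZero.mk (FreeLieAlgebra.of k i) (c i) := by
  rw [derivationHom, FreeLieAlgebra.lift_of_apply]

theorem derivationHom_fst (c : Fin 2 → L₂ k) (z : L₂ k) : (derivationHom c z).1 = z := by
  have h : (SqZero.fstHom k).comp (derivationHom c) = (LieHom.id : L₂ k →ₗ⁅k⁆ L₂ k) := by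
    apply FreeLieAlgebra.hom_ext
    intro i
    rw [LieHom.comp_apply, derivationHom_of]
    rfl
  exact LieHom.congr_fun h z

/-- The unique derivation of the free Lie algebra that sends the `i`-th generator to `c i`. -/
noncomputable def derivationOfGens (c : Fin 2 → L₂ k) : LieDerivation k (L₂ k) (L₂ k) where
  toFun z := (derivationHom c z).2
  map_add' z w := by rw [map_add]; rfl
  map_smul' r z := by rw [map_smul]; rfl
  leibniz' z w := by
    change (derivationHom c ⁅z, w⁆).2 = ⁅z, (derivationHom c w).2⁆ - ⁅w, (derivationHom c z).2⁆
    rw [LieHom.map_lie]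
    change ⁅(derivationHom c z).1, (derivationHom c w).2⁆
      + ⁅(derivationHom c z).2, (derivationHom c w).1⁆ = _
    rw [derivationHom_fst, derivationHom_fst, ← lie_skew w, sub_neg_eq_add]

theorem derivationOfGens_of (c : Fin 2 → L₂ k) (i : Fin 2) :
    derivationOfGens c (FreeLieAlgebra.of k i) = c i := by
  change (derivationHom c (FreeLieAlgebra.of k i)).2 = c i
  rw [derivationHom_of]
  rfl

theorem derivation_ext {u v : LieDerivation k (L₂ k) (L₂ k)}
    (h : ∀ i, u (FreeLieAlgebra.of k i) = v (FreeLieAlgebra.of k i)) : u = v := by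
  let F : LieDerivation k (L₂ k) (L₂ k) → (L₂ k →ₗ⁅k⁆ SqZero (L₂ k)) := fun D =>
    { toFun := fun z => SqZero.mk z (D z)
      map_add' := fun z w => by rw [map_add]; rfl
      map_smul' := fun r z => by rw [map_smul]; rfl
      map_lie' := fun {z w} => by
        apply Prod.ext
        · rfl
        · change D ⁅z, w⁆ = ⁅z, D w⁆ + ⁅D z, w⁆
          rw [LieDerivation.apply_lie_eq_add] }
  have hF : F u = F v := by
    apply FreeLieAlgebra.hom_ext
    intro i
    exact congrArg (SqZero.mk _) (h i)
  ext z
  exact congrArg Prod.snd (LieHom.congr_fun hF z)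

/-- The tangential derivation `(a, b)`, that is, `x ↦ ⁅x, a⁆`, `y ↦ ⁅y, b⁆`. -/
noncomputable def tangential : L₂ k × L₂ k →ₗ[k] LieDerivation k (L₂ k) (L₂ k) where
  toFun p := derivationOfGens ![⁅X k, p.1⁆, ⁅Y k, p.2⁆]
  map_add' p q := derivation_ext fun i => by
    rw [LieDerivation.add_apply]
    simp only [derivationOfGens_of]
    fin_cases i <;> simp
  map_smul' r p := derivation_ext fun i => by
    rw [RingHom.id_apply, LieDerivation.smul_apply]
    simp only [derivationOfGens_of]
    fin_cases i <;> simp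

theorem tangential_X (a b : L₂ k) : tangential (a, b) (X k) = ⁅X k, a⁆ :=
  derivationOfGens_of _ 0

theorem tangential_Y (a b : L₂ k) : tangential (a, b) (Y k) = ⁅Y k, b⁆ :=
  derivationOfGens_of _ 1

/-- Substitution `φ ↦ φ(a, b)` of two elements of a Lie algebra into a Lie polynomial. -/
noncomputable def subst {L : Type u} [LieRing L] [LieAlgebra k L] (a b : L) : L₂ k →ₗ⁅k⁆ L :=
  FreeLieAlgebra.lift k ![a, b]

/-- The involution of the free Lie algebra that exchanges the two generators. -/
noncomputable def swap : L₂ k →ₗ⁅k⁆ L₂ k := subst (Y k) (X k)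

/-- Iterated brackets of generators, with their degrees. -/
inductive IsLieMonomial : ℕ → L₂ k → Prop
  | gen (i : Fin 2) : IsLieMonomial 1 (FreeLieAlgebra.of k i)
  | lie {m n : ℕ} {z w : L₂ k} :
      IsLieMonomial m z → IsLieMonomial n w → IsLieMonomial (m + n) ⁅z, w⁆

variable (k) in
/-- `𝕃^{≥ d}(x, y)`: the Lie polynomials without homogeneous components of degree below `d`. -/
noncomputable def degreeGE (d : ℕ) : Submodule k (L₂ k) :=
  Submodule.span k {z | ∃ n, d ≤ n ∧ IsLieMonomial n z}

theorem degreeGE_anti {d e : ℕ} (h : d ≤ e) : degreeGE k e ≤ degreeGE k d :=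
  Submodule.span_mono fun _ ⟨n, hn, hz⟩ => ⟨n, h.trans hn, hz⟩

end Derivations

/-! ## Divergence and the symmetric Kashiwara-Vergne Lie algebra -/

section Divergence

attribute [local instance 100] LieRing.ofAssociativeRing

variable (k : Type u) [Field k]

/-- The free associative algebra `k⟨x, y⟩`. -/
abbrev Assoc : Type u := FreeAlgebra k (Fin 2)

/-- The space `|k⟨x, y⟩| = k⟨x, y⟩ / [k⟨x, y⟩, k⟨x, y⟩]` of cyclic words. The denominator is the
linear span of the commutators. -/
abbrev CyclicWords : Type u :=
  Assoc k ⧸ Submodule.span k {c : Assoc k | ∃ a b : Assoc k, c = a * b - b * a}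

/-- The projection `|·|` to cyclic words. -/
noncomputable def cyc : Assoc k →ₗ[k] CyclicWords k := Submodule.mkQ _

/-- The linear map `d_i` that deletes the leftmost letter of a word if that letter is the `i`-th
generator and sends all other words to `0`, so that `a = ε(a) + x d₀(a) + y d₁(a)`. -/
noncomputable def stripLeft (i : Fin 2) : Assoc k →ₗ[k] Assoc k :=
  (FreeAlgebra.basisFreeMonoid k (Fin 2)).constr k fun w =>
    match FreeMonoid.toList w with
    | [] => 0
    | j :: v => if j = i then FreeAlgebra.basisFreeMonoid k (Fin 2) (FreeMonoid.ofList v) else 0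

theorem basis_apply (w : FreeMonoid (Fin 2)) :
    FreeAlgebra.basisFreeMonoid k (Fin 2) w = FreeMonoid.lift (FreeAlgebra.ι k) w := by
  simp [FreeAlgebra.basisFreeMonoid, FreeAlgebra.equivMonoidAlgebraFreeMonoid]

theorem stripLeft_one (i : Fin 2) : stripLeft k i 1 = 0 := by
  have h : (1 : Assoc k) = FreeAlgebra.basisFreeMonoid k (Fin 2) 1 := by
    rw [basis_apply, map_one]
  rw [h, stripLeft, Module.Basis.constr_basis]
  rfl

theorem stripLeft_gen_mul (i j : Fin 2) (a : Assoc k) :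
    stripLeft k i (FreeAlgebra.ι k j * a) = if j = i then a else 0 := by
  have h : (stripLeft k i) ∘ₗ (LinearMap.mulLeft k (FreeAlgebra.ι k j))
      = if j = i then LinearMap.id else 0 := by
    apply (FreeAlgebra.basisFreeMonoid k (Fin 2)).ext
    intro w
    have hw : FreeAlgebra.ι k j * FreeAlgebra.basisFreeMonoid k (Fin 2) w
        = FreeAlgebra.basisFreeMonoid k (Fin 2) (FreeMonoid.of j * w) := by
      rw [basis_apply, basis_apply, map_mul, FreeMonoid.lift_eval_of]
    rw [LinearMap.comp_apply, LinearMap.mulLeft_apply, hw, stripLeft,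
      Module.Basis.constr_basis]
    change (if j = i then FreeAlgebra.basisFreeMonoid k (Fin 2) w else 0) = _
    split_ifs <;> rfl
  have := LinearMap.congr_fun h a
  rw [LinearMap.comp_apply, LinearMap.mulLeft_apply] at this
  rw [this]
  split_ifs <;> rfl

/-- The embedding of Lie polynomials into `k⟨x, y⟩`. -/
noncomputable def toAssoc : L₂ k →ₗ⁅k⁆ Assoc k := FreeLieAlgebra.lift k (FreeAlgebra.ι k)

/-- The divergence `div(a, b) = |x d₀(a) + y d₁(b)|`. -/
noncomputable def divergence : L₂ k × L₂ k →ₗ[k] CyclicWords k :=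
  cyc k ∘ₗ
    (LinearMap.mulLeft k (FreeAlgebra.ι k 0) ∘ₗ stripLeft k 0 ∘ₗ
        (toAssoc k : L₂ k →ₗ[k] Assoc k) ∘ₗ LinearMap.fst k (L₂ k) (L₂ k)
      + LinearMap.mulLeft k (FreeAlgebra.ι k 1) ∘ₗ stripLeft k 1 ∘ₗ
        (toAssoc k : L₂ k →ₗ[k] Assoc k) ∘ₗ LinearMap.snd k (L₂ k) (L₂ k))

/-- The linear map `f ↦ |f(a)|`. -/
noncomputable def cycPoly (a : Assoc k) : Polynomial k →ₗ[k] CyclicWords k :=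
  cyc k ∘ₗ (Polynomial.aeval a).toLinearMap

/-- The cyclic words `|f₀(x)| + |f₁(y)| + |f₂(-x-y)|` with one-variable `f₀`, `f₁`, `f₂`. -/
noncomputable def boundaryWords : Submodule k (CyclicWords k) :=
  (cycPoly k (FreeAlgebra.ι k 0)).range ⊔ (cycPoly k (FreeAlgebra.ι k 1)).range
    ⊔ (cycPoly k (-FreeAlgebra.ι k 0 - FreeAlgebra.ι k 1)).range

/-- The Kashiwara-Vergne Lie algebra `𝔨𝔯𝔳₂`: the derivations `u = (a, b)` that are tangential,
special (`u(-x-y) = 0`) and satisfy `div(u) = |f₀(x)| + |f₁(y)| + |f₂(-x-y)|` for some `f₀`, `f₁`,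
`f₂`. The pair `(a, b)` is determined by `u` up to adding multiples of `x` to `a` and of `y` to `b`,
which does not affect the last condition. -/
noncomputable def krv₂ : Submodule k (LieDerivation k (L₂ k) (L₂ k)) where
  carrier := {u | ∃ a b : L₂ k, u = tangential (a, b) ∧ u (-X k - Y k) = 0 ∧
    divergence k (a, b) ∈ boundaryWords k}
  zero_mem' :=
    ⟨0, 0, (map_zero tangential).symm, rfl,
      (map_zero (divergence k)).symm ▸ (boundaryWords k).zero_mem⟩
  add_mem' := by
    rintro u v ⟨a, b, hu, hu', hd⟩ ⟨a', b', hv, hv', hd'⟩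
    refine ⟨a + a', b + b', ?_, ?_, ?_⟩
    · rw [hu, hv, ← map_add, Prod.mk_add_mk]
    · rw [LieDerivation.add_apply, hu', hv', add_zero]
    · rw [← Prod.mk_add_mk, map_add]
      exact (boundaryWords k).add_mem hd hd'
  smul_mem' := by
    rintro c u ⟨a, b, hu, hu', hd⟩
    refine ⟨c • a, c • b, ?_, ?_, ?_⟩
    · rw [hu, ← map_smul, Prod.smul_mk]
    · rw [LieDerivation.smul_apply, hu', smul_zero]
    · rw [← Prod.smul_mk, map_smul]
      exact (boundaryWords k).smul_mem c hd

/-- The involution `Θ : (a(x, y), b(x, y)) ↦ (b(y, x), a(y, x))` fixes the derivation `u` if and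
only if `u` commutes with the exchange of the generators. -/
noncomputable def krvSym : Submodule k (LieDerivation k (L₂ k) (L₂ k)) where
  carrier := {u | u ∈ krv₂ k ∧ ∀ z, swap (u (swap z)) = u z}
  zero_mem' := ⟨(krv₂ k).zero_mem, fun z => by simp⟩
  add_mem' := by
    rintro u v ⟨hu, hu'⟩ ⟨hv, hv'⟩
    exact ⟨(krv₂ k).add_mem hu hv, fun z => by simp [hu', hv']⟩
  smul_mem' := by
    rintro c u ⟨hu, hu'⟩
    exact ⟨(krv₂ k).smul_mem c hu, fun z => by simp [hu']⟩

end Divergence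

/-! ## Drinfeld-Kohno Lie algebras -/

section DrinfeldKohno

open FreeLieAlgebra (of)

variable (k : Type u) [Field k]

/-- The defining relators of the Drinfeld-Kohno Lie algebra, in the free Lie algebra on symbols
`t_{ij}`. -/
inductive DKRelator (n : ℕ) : FreeLieAlgebra k (Fin n × Fin n) → Prop
  | symm (i j : Fin n) : DKRelator n (of k (i, j) - of k (j, i))
  | diag (i : Fin n) : DKRelator n (of k (i, i))
  | comm (i j l m : Fin n) : i ≠ j → i ≠ l → i ≠ m → j ≠ l → j ≠ m → l ≠ m →
      DKRelator n ⁅of k (i, j), of k (l, m)⁆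
  | fourTerm (i j l : Fin n) : i ≠ j → i ≠ l → j ≠ l →
      DKRelator n ⁅of k (i, j), of k (i, l) + of k (j, l)⁆

/-- The ideal generated by the relators. -/
noncomputable def dkIdeal (n : ℕ) : LieIdeal k (FreeLieAlgebra k (Fin n × Fin n)) :=
  LieSubmodule.lieSpan k (FreeLieAlgebra k (Fin n × Fin n)) {r | DKRelator k n r}

/-- The Drinfeld-Kohno Lie algebra `𝔱_n` (strands are numbered from `0`). -/
abbrev DK (n : ℕ) : Type u := FreeLieAlgebra k (Fin n × Fin n) ⧸ dkIdeal k n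

/-- The generator `t_{ij}`. -/
noncomputable def t {n : ℕ} (i j : Fin n) : DK k n :=
  LieSubmodule.Quotient.mk (of k (i, j))

theorem mk_relator {n : ℕ} {r : FreeLieAlgebra k (Fin n × Fin n)} (h : DKRelator k n r) :
    (LieSubmodule.Quotient.mk r : DK k n) = 0 :=
  LieSubmodule.Quotient.mk_eq_zero'.mpr (LieSubmodule.subset_lieSpan h)

theorem t_symm {n : ℕ} (i j : Fin n) : t k i j = t k j i :=
  sub_eq_zero.mp (mk_relator k (DKRelator.symm i j))

theorem t_comm {n : ℕ} {i j l m : Fin n} (h₁ : i ≠ j) (h₂ : i ≠ l) (h₃ : i ≠ m) (h₄ : j ≠ l)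
    (h₅ : j ≠ m) (h₆ : l ≠ m) : ⁅t k i j, t k l m⁆ = 0 :=
  mk_relator k (DKRelator.comm i j l m h₁ h₂ h₃ h₄ h₅ h₆)

theorem t_fourTerm {n : ℕ} {i j l : Fin n} (h₁ : i ≠ j) (h₂ : i ≠ l) (h₃ : j ≠ l) :
    ⁅t k i j, t k i l + t k j l⁆ = 0 :=
  mk_relator k (DKRelator.fourTerm i j l h₁ h₂ h₃)

variable {k} in
/-- A morphism out of the free Lie algebra that kills the relators descends to `𝔱_n`. -/
noncomputable def DK.lift {n : ℕ} {M : Type u} [LieRing M] [LieAlgebra k M]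
    (F : FreeLieAlgebra k (Fin n × Fin n) →ₗ⁅k⁆ M) (hF : ∀ r, DKRelator k n r → F r = 0) :
    DK k n →ₗ⁅k⁆ M :=
  have hle : dkIdeal k n ≤ F.ker :=
    LieSubmodule.lieSpan_le.mpr fun r hr => LieHom.mem_ker.mpr (hF r hr)
  { (dkIdeal k n).toSubmodule.liftQ (F : FreeLieAlgebra k (Fin n × Fin n) →ₗ[k] M)
      (fun z hz => LieHom.mem_ker.mp (hle hz)) with
    map_lie' := by
      intro z w
      obtain ⟨z, rfl⟩ := LieSubmodule.Quotient.surjective_mk' _ z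
      obtain ⟨w, rfl⟩ := LieSubmodule.Quotient.surjective_mk' _ w
      exact F.map_lie z w }

theorem DK.lift_t {n : ℕ} {M : Type u} [LieRing M] [LieAlgebra k M]
    (F : FreeLieAlgebra k (Fin n × Fin n) →ₗ⁅k⁆ M) (hF : ∀ r, DKRelator k n r → F r = 0)
    (i j : Fin n) : DK.lift F hF (t k i j) = F (of k (i, j)) := rfl

/-- The value of `t_{ij}^f`: the sum of `t_{i'j'}` over `i' ∈ f⁻¹(i)`, `j' ∈ f⁻¹(j)` for
`i ≠ j`, and `0` for `i = j`. -/
noncomputable def cableGen {m n : ℕ} (f : Fin m → Option (Fin n)) (i j : Fin n) : DK k m :=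
  if i = j then 0 else
    ∑ i' : Fin m with f i' = some i, ∑ j' : Fin m with f j' = some j, t k i' j'

theorem cableGen_relator {m n : ℕ} (f : Fin m → Option (Fin n))
    (r : FreeLieAlgebra k (Fin n × Fin n)) (hr : DKRelator k n r) :
    FreeLieAlgebra.lift k (fun p : Fin n × Fin n => cableGen k f p.1 p.2) r = 0 := by
  have hne : ∀ {i j : Fin n} {i' j' : Fin m}, i ≠ j → f i' = some i → f j' = some j → i' ≠ j' := by
    rintro i j i' j' h h₁ h₂ rfl
    exact h (Option.some.inj (h₁.symm.trans h₂))
  cases hr with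
  | symm i j =>
    rw [map_sub, FreeLieAlgebra.lift_of_apply, FreeLieAlgebra.lift_of_apply, sub_eq_zero]
    simp only [cableGen]
    by_cases h : i = j
    · rw [if_pos h, if_pos h.symm]
    · rw [if_neg h, if_neg (Ne.symm h), Finset.sum_comm]
      exact Finset.sum_congr rfl fun _ _ => Finset.sum_congr rfl fun _ _ => t_symm k _ _
  | diag i =>
    rw [FreeLieAlgebra.lift_of_apply]
    simp only [cableGen, if_true]
  | comm i j l m h₁ h₂ h₃ h₄ h₅ h₆ =>
    rw [LieHom.map_lie, FreeLieAlgebra.lift_of_apply, FreeLieAlgebra.lift_of_apply]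
    simp only [cableGen, if_neg h₁, if_neg h₆, sum_lie, lie_sum]
    refine Finset.sum_eq_zero fun c hc => Finset.sum_eq_zero fun d hd =>
      Finset.sum_eq_zero fun a ha => Finset.sum_eq_zero fun b hb => ?_
    simp only [Finset.mem_filter, Finset.mem_univ, true_and] at ha hb hc hd
    first
      | exact t_comm k (hne h₁ hc hd) (hne h₂ hc ha) (hne h₃ hc hb) (hne h₄ hd ha)
          (hne h₅ hd hb) (hne h₆ ha hb)
      | exact t_comm k (hne h₁ ha hb) (hne h₂ ha hc) (hne h₃ ha hd) (hne h₄ hb hc)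
          (hne h₅ hb hd) (hne h₆ hc hd)
  | fourTerm i j l h₁ h₂ h₃ =>
    rw [LieHom.map_lie, map_add, FreeLieAlgebra.lift_of_apply, FreeLieAlgebra.lift_of_apply,
      FreeLieAlgebra.lift_of_apply]
    simp only [cableGen, if_neg h₁, if_neg h₂, if_neg h₃]
    rw [sum_lie]
    refine Finset.sum_eq_zero fun a ha => ?_
    rw [sum_lie]
    refine Finset.sum_eq_zero fun b hb => ?_
    simp only [Finset.mem_filter, Finset.mem_univ, true_and] at ha hb
    have e₁ : ⁅t k a b, ∑ a' : Fin m with f a' = some i, ∑ c : Fin m with f c = some l, t k a' c⁆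
        = ∑ c : Fin m with f c = some l, ⁅t k a b, t k a c⁆ := by
      rw [lie_sum, Finset.sum_eq_single a]
      · rw [lie_sum]
      · intro a' ha' haa
        rw [lie_sum]
        refine Finset.sum_eq_zero fun c hc => ?_
        simp only [Finset.mem_filter, Finset.mem_univ, true_and] at hc ha'
        exact t_comm k (hne h₁ ha hb) (Ne.symm haa) (hne h₂ ha hc) (hne h₁ ha' hb).symm
          (hne h₃ hb hc) (hne h₂ ha' hc)
      · intro h
        exact absurd (by simpa using ha) h
    have e₂ : ⁅t k a b, ∑ b' : Fin m with f b' = some j, ∑ c : Fin m with f c = some l, t k b' c⁆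
        = ∑ c : Fin m with f c = some l, ⁅t k a b, t k b c⁆ := by
      rw [lie_sum, Finset.sum_eq_single b]
      · rw [lie_sum]
      · intro b' hb' hbb
        rw [lie_sum]
        refine Finset.sum_eq_zero fun c hc => ?_
        simp only [Finset.mem_filter, Finset.mem_univ, true_and] at hc hb'
        exact t_comm k (hne h₁ ha hb) (hne h₁ ha hb') (hne h₂ ha hc) (Ne.symm hbb) (hne h₃ hb hc)
          (hne h₃ hb' hc)
      · intro h
        exact absurd (by simpa using hb) h
    rw [lie_add, e₁, e₂, ← Finset.sum_add_distrib]
    refine Finset.sum_eq_zero fun c hc => ?_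
    simp only [Finset.mem_filter, Finset.mem_univ, true_and] at hc
    rw [← lie_add]
    exact t_fourTerm k (hne h₁ ha hb) (hne h₂ ha hc) (hne h₃ hb hc)

/-- The morphism `g ↦ g^f = g^{f⁻¹(1), …, f⁻¹(n)}` from `𝔱_n` to `𝔱_m` of a partially defined map
`f` from `{1, …, m}` to `{1, …, n}`. -/
noncomputable def cable {m n : ℕ} (f : Fin m → Option (Fin n)) : DK k n →ₗ⁅k⁆ DK k m :=
  DK.lift (FreeLieAlgebra.lift k fun p : Fin n × Fin n => cableGen k f p.1 p.2)
    (cableGen_relator k f)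

/-- The projection `pr^i : 𝔱_{n+1} → 𝔱_n` that deletes the strand `i`: it kills `t_{ij}` for all
`j`, and renumbers the remaining strands. -/
noncomputable def pr {n : ℕ} (i : Fin (n + 1)) : DK k (n + 1) →ₗ⁅k⁆ DK k n :=
  cable k fun j => some (i.succAbove j)

/-- The Brunnian Lie algebra `𝔟𝔯𝔲𝔫_{2,2} = ker pr³ ∩ ker pr⁴` in `𝔱₄`. It is automatically contained
in `𝔡𝔨_{2,2} = ker (pr³ ∘ pr⁴)`. -/
noncomputable def brun₂₂ : LieIdeal k (DK k 4) := (pr k (2 : Fin 4)).ker ⊓ (pr k (3 : Fin 4)).ker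

variable {k}

/-- The pentagon map `g ↦ g^{1,2,3} + g^{1,23,4} + g^{2,3,4} - g^{12,3,4} - g^{1,2,34}`. -/
noncomputable def pent (g : DK k 3) : DK k 4 :=
  cable k ![some 0, some 1, some 2, none] g + cable k ![some 0, some 1, some 1, some 2] g
    + cable k ![none, some 0, some 1, some 2] g - cable k ![some 0, some 0, some 1, some 2] g
    - cable k ![some 0, some 1, some 2, some 2] g

/-- `pent(φ(t₁₂, t₂₃))`. -/
noncomputable def pentagon (φ : L₂ k) : DK k 4 := pent (subst (t k 0 1) (t k 1 2) φ)

theorem cable_t {m n : ℕ} (f : Fin m → Option (Fin n)) (i j : Fin n) :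
    cable k f (t k i j) = cableGen k f i j := by
  rw [cable, t, ← t, DK.lift_t, FreeLieAlgebra.lift_of_apply]

theorem map_subst {L M : Type u} [LieRing L] [LieAlgebra k L] [LieRing M] [LieAlgebra k M]
    (F : L →ₗ⁅k⁆ M) (a b : L) (φ : L₂ k) : F (subst a b φ) = subst (F a) (F b) φ := by
  have h : F.comp (subst a b) = subst (F a) (F b) := by
    apply FreeLieAlgebra.hom_ext
    intro i
    rw [LieHom.comp_apply, subst, subst, FreeLieAlgebra.lift_of_apply,
      FreeLieAlgebra.lift_of_apply]
    fin_cases i <;> rfl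
  exact LieHom.congr_fun h φ

theorem subst_eq_zero {L : Type u} [LieRing L] [LieAlgebra k L] (c : L) (p q : k)
    {φ : L₂ k} (hφ : φ ∈ degreeGE k 2) : subst (p • c) (q • c) φ = 0 := by
  have key : ∀ {n : ℕ} {z : L₂ k}, IsLieMonomial n z →
      ∃ r : k, subst (p • c) (q • c) z = r • c ∧ (2 ≤ n → r • c = 0) := by
    intro n z hz
    induction hz with
    | gen i =>
      refine ⟨![p, q] i, ?_, fun h => absurd h (by norm_num)⟩
      rw [subst, FreeLieAlgebra.lift_of_apply]
      fin_cases i <;> rfl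
    | lie _ _ hz hw =>
      obtain ⟨r, hr, -⟩ := hz
      obtain ⟨s, hs, -⟩ := hw
      refine ⟨0, ?_, fun _ => zero_smul _ _⟩
      rw [LieHom.map_lie, hr, hs, smul_lie, lie_smul, lie_self, smul_zero, smul_zero, zero_smul]
  induction hφ using Submodule.span_induction with
  | mem z hz =>
    obtain ⟨n, hn, hz⟩ := hz
    obtain ⟨r, hr, hr'⟩ := key hz
    rw [hr, hr' hn]
  | zero => exact map_zero _
  | add z w _ _ hz hw => rw [map_add, hz, hw, add_zero]
  | smul r z _ hz => rw [map_smul, hz, smul_zero]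

theorem subst_zero_left {L : Type u} [LieRing L] [LieAlgebra k L] (c : L)
    {φ : L₂ k} (hφ : φ ∈ degreeGE k 2) : subst 0 c φ = 0 := by
  have := subst_eq_zero c 0 1 hφ
  rwa [zero_smul, one_smul] at this

theorem subst_zero_right {L : Type u} [LieRing L] [LieAlgebra k L] (c : L)
    {φ : L₂ k} (hφ : φ ∈ degreeGE k 2) : subst c 0 φ = 0 := by
  have := subst_eq_zero c 1 0 hφ
  rwa [zero_smul, one_smul] at this

/-- The explicit form of the pentagon map. -/
theorem pentagon_eq (φ : L₂ k) : pentagon φ =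
    subst (t k 0 1) (t k 1 2) φ + subst (t k 0 1 + t k 0 2) (t k 1 3 + t k 2 3) φ
      + subst (t k 1 2) (t k 2 3) φ - subst (t k 0 2 + t k 1 2) (t k 2 3) φ
      - subst (t k 0 1) (t k 1 2 + t k 1 3) φ := by
  simp only [pentagon, pent, map_subst, cable_t, cableGen, Finset.sum_filter, Fin.sum_univ_four]
  simp

theorem pr_t {n : ℕ} (l : Fin (n + 1)) (i j : Fin n) (h : i ≠ j) :
    pr k l (t k (l.succAbove i) (l.succAbove j)) = t k i j := by
  rw [pr, cable_t, cableGen, if_neg (fun e => h (Fin.succAbove_right_injective e))]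
  simp [Finset.sum_filter]

theorem pr_t_left {n : ℕ} (l j : Fin (n + 1)) : pr k l (t k l j) = 0 := by
  rw [pr, cable_t, cableGen]
  simp

theorem pr_t_right {n : ℕ} (l j : Fin (n + 1)) : pr k l (t k j l) = 0 := by
  rw [t_symm, pr_t_left]

theorem pentagon_mem {φ : L₂ k} (hφ : φ ∈ degreeGE k 2) : pentagon φ ∈ brun₂₂ k := by
  rw [brun₂₂, LieSubmodule.mem_inf]
  constructor
  · have h₁ : pr k 2 (t k 0 1) = t k (0 : Fin 3) 1 := pr_t 2 0 1 (by decide)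
    have h₂ : pr k 2 (t k 1 3) = t k (1 : Fin 3) 2 := pr_t 2 1 2 (by decide)
    rw [LieHom.mem_ker, pentagon_eq]
    simp only [map_sub, map_add, map_subst, pr_t_left, pr_t_right, h₁, h₂, zero_add, add_zero,
      subst_zero_left _ hφ, subst_zero_right _ hφ, sub_zero, sub_self]
  · have h₁ : pr k 3 (t k 0 1) = t k (0 : Fin 3) 1 := pr_t 3 0 1 (by decide)
    have h₂ : pr k 3 (t k 1 2) = t k (1 : Fin 3) 2 := pr_t 3 1 2 (by decide)
    rw [LieHom.mem_ker, pentagon_eq]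
    simp only [map_sub, map_add, map_subst, pr_t_right, h₁, h₂, add_zero,
      subst_zero_right _ hφ, sub_zero, sub_self]

/-- The map `pent¹_krv`: the class of `pent(φ(t₁₂, t₂₃))` in `J / [J, J]` for `J = 𝔟𝔯𝔲𝔫_{2,2}`. -/
noncomputable def pentKrv (φ : L₂ k) (hφ : φ ∈ degreeGE k 2) :
    ↥(brun₂₂ k) ⧸ (⁅(⊤ : LieIdeal k ↥(brun₂₂ k)), (⊤ : LieIdeal k ↥(brun₂₂ k))⁆ :
      LieIdeal k ↥(brun₂₂ k)) :=
  LieSubmodule.Quotient.mk (⟨pentagon φ, pentagon_mem hφ⟩ : ↥(brun₂₂ k))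

end DrinfeldKohno

end KashiwaraVergne

open KashiwaraVergne

/-! Put `a = φ(-x-y, x)` and `b = φ(-x-y, y)`, and let `F` be the polynomial whose coefficient at
`Tⁿ` is the coefficient of the word `y xⁿ` in `φ`. Granted equation 1, the divergence condition and
the pentagon condition are both equivalent to one identity in `k⟨x, y⟩`: (*) `stripRight 1 b + merge
b = F(x+y) - F(y)`.

Pentagon. The abelianization of `brun₂₂` is a copy of `k⟨x, y⟩`: the word `w` stands for
`ad_w(t₃₄)`, with `x, y` acting as `t₁₄, t₂₄`. These elements span modulo commutators
(`mem_brunSpan`), because together with the Lie algebra generated by `t₁₄, t₂₄` they span an ideal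
of `𝔱₄`. They are independent because the explicit morphism `pentHom` recovers the word. Its target
is an extension of `𝕃 ⊕ 𝕃` by the bimodule `k⟨x, y⟩`: the two Lie components record what remains
after forgetting strand 4 or strand 3, and the cocycle is built from `overlap`. Evaluated on the
five terms of the pentagon, the bimodule component is the left side of (*) minus the right side
(`pentHom_pentagon_md`).

Divergence. Equation 1 says that `xa + yb = ax + by`, so the coefficients of this element are
invariant under rotation of words. Therefore the cyclic derivative of the divergence with respect to
`y` is the left side of (*), and the one with respect to `x` is its image under the swap
(`cycDeriv_divergence`). In characteristic 0 the cyclic derivatives determine a cyclic word up to a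
constant (`cyc_eq_of_cycDeriv_eq_zero`), and the derivatives of `|f₀(x)| + |f₁(y)| + |f₂(-x-y)|`
have the form `f_i'(x_i) - f₂'(-x-y)`. Comparing the coefficients of pure powers of `x` and of `y`
expresses these polynomials through `F`, which gives (*).

The invariance under the involution is automatic, since the swap exchanges `a` and `b`. -/

namespace KashiwaraVergne

universe u

/-! ### Letter-stripping, overlapping and merging in `k⟨x, y⟩` -/

section FreeAssociative

open FreeAlgebra (ι)

attribute [local instance 100] LieRing.ofAssociativeRing

variable (k : Type u) [Field k]

/-- The word with the given letters. -/
noncomputable def word (w : List (Fin 2)) : Assoc k := (w.map (ι k)).prod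

variable {k}

@[simp] theorem word_nil : word k [] = 1 := rfl

@[simp] theorem word_cons (i : Fin 2) (w : List (Fin 2)) : word k (i :: w) = ι k i * word k w :=
  List.prod_cons

theorem word_append (v w : List (Fin 2)) : word k (v ++ w) = word k v * word k w := by
  simp [word]

theorem basis_eq_word (w : FreeMonoid (Fin 2)) :
    FreeAlgebra.basisFreeMonoid k (Fin 2) w = word k (FreeMonoid.toList w) := by
  rw [basis_apply, FreeMonoid.lift_apply, word]

theorem span_word : Submodule.span k (Set.range (word k)) = ⊤ := by
  rw [← (FreeAlgebra.basisFreeMonoid k (Fin 2)).span_eq]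
  congr 1
  ext a
  constructor
  · rintro ⟨w, rfl⟩
    exact ⟨FreeMonoid.ofList w, basis_eq_word _⟩
  · rintro ⟨w, rfl⟩
    exact ⟨FreeMonoid.toList w, (basis_eq_word _).symm⟩

/-- The linear map with the given values on words. -/
noncomputable def onWords {M : Type*} [AddCommGroup M] [Module k M] (f : List (Fin 2) → M) :
    Assoc k →ₗ[k] M :=
  (FreeAlgebra.basisFreeMonoid k (Fin 2)).constr k fun w => f (FreeMonoid.toList w)

@[simp] theorem onWords_word {M : Type*} [AddCommGroup M] [Module k M] (f : List (Fin 2) → M)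
    (w : List (Fin 2)) : onWords f (word k w) = f w := by
  have := basis_eq_word (k := k) (FreeMonoid.ofList w)
  rw [FreeMonoid.toList_ofList] at this
  rw [onWords, ← this, Module.Basis.constr_basis]
  rfl

theorem linearMap_ext_word {M : Type*} [AddCommGroup M] [Module k M] {f g : Assoc k →ₗ[k] M}
    (h : ∀ w, f (word k w) = g (word k w)) : f = g :=
  LinearMap.ext_on span_word (by rintro _ ⟨w, rfl⟩; exact h w)

/-- Induction on the length of words, adding letters on the left. -/
theorem assoc_induction {P : Assoc k → Prop} (one : P 1) (gen_mul : ∀ i a, P a → P (ι k i * a))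
    (add : ∀ a b, P a → P b → P (a + b)) (smul : ∀ (c : k) a, P a → P (c • a)) (a : Assoc k) :
    P a := by
  have hw : ∀ w, P (word k w) := fun w => by
    induction w with
    | nil => exact one
    | cons i w ih => rw [word_cons]; exact gen_mul _ _ ih
  have ha : a ∈ Submodule.span k (Set.range (word k)) := by rw [span_word]; exact Submodule.mem_top
  induction ha using Submodule.span_induction with
  | mem z hz => obtain ⟨w, rfl⟩ := hz; exact hw w
  | zero => simpa using smul 0 1 one
  | add z w _ _ hz hw => exact add _ _ hz hw
  | smul r z _ hz => exact smul _ _ hz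

/-- The augmentation. -/
noncomputable abbrev aug : Assoc k →ₐ[k] k := FreeAlgebra.algebraMapInv

@[simp] theorem aug_gen (i : Fin 2) : aug (ι k i) = 0 := by simp [aug, FreeAlgebra.algebraMapInv]

theorem eq_sum_stripLeft (a : Assoc k) :
    a = algebraMap k _ (aug a) + ∑ i, ι k i * stripLeft k i a := by
  induction a using assoc_induction with
  | one => simp [stripLeft_one]
  | gen_mul i a ha => simp [stripLeft_gen_mul]
  | add a b ha hb =>
    nth_rw 1 [ha, hb]
    simp only [map_add, mul_add, Finset.sum_add_distrib]
    abel
  | smul c a ha =>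
    nth_rw 1 [ha]
    simp only [map_smul, smul_add, Finset.smul_sum, mul_smul_comm, Algebra.algebraMap_eq_smul_one,
      smul_assoc]

theorem stripLeft_mul (i : Fin 2) (a b : Assoc k) :
    stripLeft k i (a * b) = stripLeft k i a * b + aug a • stripLeft k i b := by
  induction a using assoc_induction with
  | one => simp [stripLeft_one]
  | gen_mul j a ha =>
    rw [mul_assoc, stripLeft_gen_mul, stripLeft_gen_mul]
    split_ifs <;> simp
  | add a a' ha ha' => simp only [add_mul, map_add, ha, ha', add_smul]; abel
  | smul c a ha => simp only [smul_mul_assoc, map_smul, ha, smul_add, smul_assoc]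

theorem stripLeft_gen (i j : Fin 2) : stripLeft k i (ι k j) = if j = i then 1 else 0 := by
  have := stripLeft_gen_mul k i j 1
  rwa [mul_one] at this

/-- The values of `stripRight` on words. -/
noncomputable def stripRightWord (i : Fin 2) : List (Fin 2) → Assoc k
  | [] => 0
  | j :: w => ι k j * stripRightWord i w + if w = [] ∧ j = i then 1 else 0

/-- The linear map that deletes the rightmost letter of a word if that letter is the `i`-th
generator and sends all other words to `0`. -/
noncomputable def stripRight (i : Fin 2) : Assoc k →ₗ[k] Assoc k := onWords (stripRightWord i)

theorem aug_word (w : List (Fin 2)) : aug (word k w) = if w = [] then 1 else 0 := by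
  cases w <;> simp

@[simp] theorem stripRight_one (i : Fin 2) : stripRight i (1 : Assoc k) = 0 :=
  onWords_word _ []

theorem stripRight_gen_mul (i j : Fin 2) (a : Assoc k) :
    stripRight i (ι k j * a) = ι k j * stripRight i a + if j
      = i then algebraMap k _ (aug a) else 0 := by
  have h : stripRight i ∘ₗ LinearMap.mulLeft k (ι k j) = LinearMap.mulLeft k (ι k j) ∘ₗ stripRight i
      + if j = i then Algebra.linearMap k _ ∘ₗ aug.toLinearMap else 0 := by
    apply linearMap_ext_word
    intro w
    simp only [LinearMap.comp_apply, LinearMap.mulLeft_apply, LinearMap.add_apply]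
    rw [← word_cons, stripRight, onWords_word, onWords_word, stripRightWord]
    split_ifs <;> simp_all [aug_word]
  have := LinearMap.congr_fun h a
  simp only [LinearMap.comp_apply, LinearMap.mulLeft_apply, LinearMap.add_apply] at this
  rw [this]
  split_ifs <;> rfl

theorem stripRight_mul (i : Fin 2) (a b : Assoc k) :
    stripRight i (a * b) = a * stripRight i b + aug b • stripRight i a := by
  induction a using assoc_induction with
  | one => simp
  | gen_mul j a ha =>
    rw [mul_assoc, stripRight_gen_mul, stripRight_gen_mul, ha]
    split_ifs <;> simp [mul_add, mul_assoc, Algebra.algebraMap_eq_smul_one, smul_smul, mul_comm,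
      add_assoc]
  | add a a' ha ha' => simp only [add_mul, map_add, ha, ha', smul_add]; abel
  | smul c a ha => simp only [smul_mul_assoc, map_smul, ha, smul_add, smul_comm (aug b) c]

theorem stripRight_gen (i j : Fin 2) : stripRight i (ι k j) = if j = i then 1 else 0 := by
  have := stripRight_gen_mul i j (1 : Assoc k)
  simpa using this

/-- The concatenation of two words with the last letter of the first and the first letter of the
second merged, if these letters are equal. -/
noncomputable def overlap (a b : Assoc k) : Assoc k :=
  ∑ i, stripRight i a * ι k i * stripLeft k i b

/-- On elements without constant term, in particular on Lie polynomials, `overlap` is left linear in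
its first argument and, by the next lemma, right linear in its second. This is what makes it a
cocycle. -/
theorem overlap_mul_left (a b c : Assoc k) :
    overlap (a * b) c = a * overlap b c + aug b • overlap a c := by
  simp only [overlap, stripRight_mul, add_mul, Finset.sum_add_distrib, Finset.mul_sum,
    Finset.smul_sum, smul_mul_assoc, mul_assoc]

theorem overlap_mul_right (a b c : Assoc k) :
    overlap a (b * c) = overlap a b * c + aug b • overlap a c := by
  simp only [overlap, stripLeft_mul, mul_add, Finset.sum_add_distrib, Finset.sum_mul,
    Finset.smul_sum, mul_smul_comm, mul_assoc]

@[simp] theorem overlap_add_left (a b c : Assoc k) :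
    overlap (a + b) c = overlap a c + overlap b c := by
  simp [overlap, add_mul, Finset.sum_add_distrib]

@[simp] theorem overlap_add_right (a b c : Assoc k) :
    overlap a (b + c) = overlap a b + overlap a c := by
  simp [overlap, mul_add, Finset.sum_add_distrib]

@[simp] theorem overlap_smul_left (r : k) (a c : Assoc k) :
    overlap (r • a) c = r • overlap a c := by
  simp [overlap]

@[simp] theorem overlap_smul_right (r : k) (a c : Assoc k) :
    overlap a (r • c) = r • overlap a c := by
  simp [overlap]

@[simp] theorem overlap_neg_left (a c : Assoc k) : overlap (-a) c = -overlap a c := by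
  simpa using overlap_smul_left (-1) a c

@[simp] theorem overlap_neg_right (a c : Assoc k) : overlap a (-c) = -overlap a c := by
  simpa using overlap_smul_right (-1) a c

@[simp] theorem overlap_sub_left (a b c : Assoc k) :
    overlap (a - b) c = overlap a c - overlap b c := by
  simp [sub_eq_add_neg]

@[simp] theorem overlap_sub_right (a b c : Assoc k) :
    overlap a (b - c) = overlap a b - overlap a c := by
  simp [sub_eq_add_neg]

@[simp] theorem overlap_zero_left (c : Assoc k) : overlap 0 c = 0 := by simp [overlap]

@[simp] theorem overlap_zero_right (c : Assoc k) : overlap c 0 = 0 := by simp [overlap]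

theorem overlap_gen_gen (i j : Fin 2) : overlap (ι k i) (ι k j) = if i = j then ι k i else 0 := by
  by_cases h : i = j
  · simp [overlap, stripLeft_gen, stripRight_gen, h]
  · simp [overlap, stripLeft_gen, stripRight_gen, h]

/-- The values of `merge` on words. -/
noncomputable def mergeWord : List (Fin 2) → Assoc k
  | [] => 0
  | j :: w => ι k j * (mergeWord w + stripLeft k j (word k w))

/-- The sum over all pairs of equal adjacent letters of a word, with this pair replaced by a
single letter. -/
noncomputable def merge : Assoc k →ₗ[k] Assoc k := onWords mergeWord

@[simp] theorem merge_one : merge (1 : Assoc k) = 0 := onWords_word _ []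

theorem merge_gen_mul (i : Fin 2) (a : Assoc k) :
    merge (ι k i * a) = ι k i * (merge a + stripLeft k i a) := by
  have h : merge ∘ₗ LinearMap.mulLeft k (ι k i)
      = LinearMap.mulLeft k (ι k i) ∘ₗ (merge + stripLeft k i) := by
    apply linearMap_ext_word
    intro w
    simp only [LinearMap.comp_apply, LinearMap.mulLeft_apply, LinearMap.add_apply]
    rw [← word_cons, merge, onWords_word, onWords_word, mergeWord]
  exact LinearMap.congr_fun h a

theorem merge_gen (i : Fin 2) : merge (ι k i) = 0 := by
  simpa [stripLeft_one] using merge_gen_mul i (1 : Assoc k)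

/-- An equal adjacent pair in a concatenation lies in the first word, in the second, or across the
junction. So `merge` is a derivation up to `overlap`, and it trivializes the cocycle of `PentExt` on
the diagonal. -/
theorem merge_mul (a b : Assoc k) : merge (a * b) = merge a * b + a * merge b + overlap a b := by
  induction a using assoc_induction with
  | one => simp [overlap]
  | gen_mul i a ha =>
    have : overlap (ι k i) b = ι k i * stripLeft k i b := by
      simp [overlap, stripRight_gen, ite_mul]
    rw [mul_assoc, merge_gen_mul, merge_gen_mul, ha, stripLeft_mul, overlap_mul_left, this]
    simp only [mul_add, add_mul, mul_assoc, mul_smul_comm]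
    abel
  | add a a' ha ha' => simp only [add_mul, map_add, ha, ha', overlap_add_left]; abel
  | smul c a ha => simp only [smul_mul_assoc, map_smul, ha, overlap_smul_left, smul_add]

theorem toAssoc_lie (z w : L₂ k) :
    toAssoc k ⁅z, w⁆ = toAssoc k z * toAssoc k w - toAssoc k w * toAssoc k z := by
  rw [LieHom.map_lie, LieRing.of_associative_ring_bracket]

@[simp] theorem toAssoc_of (i : Fin 2) : toAssoc k (FreeLieAlgebra.of k i) = ι k i := by
  rw [toAssoc, FreeLieAlgebra.lift_of_apply]

@[simp] theorem toAssoc_X : toAssoc k (X k) = ι k 0 := toAssoc_of 0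

@[simp] theorem toAssoc_Y : toAssoc k (Y k) = ι k 1 := toAssoc_of 1

/-- Induction on Lie polynomials. -/
theorem lie_induction {X' : Type*} {P : FreeLieAlgebra k X' → Prop}
    (gen : ∀ i, P (FreeLieAlgebra.of k i))
    (lie : ∀ z w, P z → P w → P ⁅z, w⁆) (add : ∀ z w, P z → P w → P (z + w))
    (smul : ∀ (c : k) z, P z → P (c • z)) (zero : P 0) (z : FreeLieAlgebra k X') : P z := by
  let S : LieSubalgebra k (FreeLieAlgebra k X') :=
    { carrier := {z | P z}
      zero_mem' := zero
      add_mem' := fun {a b} ha hb => add a b ha hb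
      smul_mem' := fun c z hz => smul c z hz
      lie_mem' := fun {a b} ha hb => lie a b ha hb }
  let F : FreeLieAlgebra k X' →ₗ⁅k⁆ S :=
    FreeLieAlgebra.lift k fun i => ⟨FreeLieAlgebra.of k i, gen i⟩
  have h : S.incl.comp F = LieHom.id := by
    apply FreeLieAlgebra.hom_ext
    intro i
    simp [F, FreeLieAlgebra.lift_of_apply]
  have h2 := LieHom.congr_fun h z
  change ((F z : S) : FreeLieAlgebra k X') = z at h2
  rw [← h2]
  exact (F z).2

@[simp] theorem aug_toAssoc (z : L₂ k) : aug (toAssoc k z) = 0 := by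
  induction z using lie_induction with
  | gen i => simp
  | lie z w hz hw => rw [toAssoc_lie, map_sub, map_mul, map_mul, hz, hw]; simp
  | add z w hz hw => rw [map_add, map_add, hz, hw, add_zero]
  | smul c z hz => rw [map_smul, map_smul, hz, smul_zero]
  | zero => simp

end FreeAssociative

/-! ### The extension of `𝕃 ⊕ 𝕃` by `k⟨x, y⟩` and the morphism from `𝔱₄` -/

section PentExt

open FreeAlgebra (ι)

attribute [local instance 100] LieRing.ofAssociativeRing

variable (k : Type u) [Field k]

/-- The extension of `𝕃(x, y) ⊕ 𝕃(x, y)` by the bimodule `k⟨x, y⟩` with the cocycle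
`((b, a), (b', a')) ↦ overlap a' b - overlap a b'`. -/
def PentExt : Type u := L₂ k × L₂ k × Assoc k

noncomputable instance : AddCommGroup (PentExt k) := inferInstanceAs (AddCommGroup (L₂ k × L₂ k
  × Assoc k))

noncomputable instance : Module k (PentExt k) := inferInstanceAs (Module k (L₂ k × L₂ k × Assoc k))

variable {k}

/-- The element with the given components. -/
def PentExt.mk (b a : L₂ k) (m : Assoc k) : PentExt k := (b, a, m)

/-- The component on which the algebra acts from the right. -/
def PentExt.rt (p : PentExt k) : L₂ k := p.1

/-- The component on which the algebra acts from the left. -/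
def PentExt.lt (p : PentExt k) : L₂ k := p.2.1

/-- The component in the bimodule. -/
def PentExt.md (p : PentExt k) : Assoc k := p.2.2

@[ext] theorem PentExt.ext {p q : PentExt k} (h₁ : p.rt = q.rt) (h₂ : p.lt = q.lt)
    (h₃ : p.md = q.md) : p = q := Prod.ext h₁ (Prod.ext h₂ h₃)

@[simp] theorem PentExt.rt_mk (b a : L₂ k) (m : Assoc k) : (PentExt.mk b a m).rt = b := rfl
@[simp] theorem PentExt.lt_mk (b a : L₂ k) (m : Assoc k) : (PentExt.mk b a m).lt = a := rfl
@[simp] theorem PentExt.md_mk (b a : L₂ k) (m : Assoc k) : (PentExt.mk b a m).md = m := rfl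
@[simp] theorem PentExt.rt_add (p q : PentExt k) : (p + q).rt = p.rt + q.rt := rfl
@[simp] theorem PentExt.lt_add (p q : PentExt k) : (p + q).lt = p.lt + q.lt := rfl
@[simp] theorem PentExt.md_add (p q : PentExt k) : (p + q).md = p.md + q.md := rfl
@[simp] theorem PentExt.rt_sub (p q : PentExt k) : (p - q).rt = p.rt - q.rt := rfl
@[simp] theorem PentExt.lt_sub (p q : PentExt k) : (p - q).lt = p.lt - q.lt := rfl
@[simp] theorem PentExt.md_sub (p q : PentExt k) : (p - q).md = p.md - q.md := rfl
@[simp] theorem PentExt.rt_smul (c : k) (p : PentExt k) : (c • p).rt = c • p.rt := rfl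
@[simp] theorem PentExt.lt_smul (c : k) (p : PentExt k) : (c • p).lt = c • p.lt := rfl
@[simp] theorem PentExt.md_smul (c : k) (p : PentExt k) : (c • p).md = c • p.md := rfl
@[simp] theorem PentExt.rt_zero : (0 : PentExt k).rt = 0 := rfl
@[simp] theorem PentExt.lt_zero : (0 : PentExt k).lt = 0 := rfl
@[simp] theorem PentExt.md_zero : (0 : PentExt k).md = 0 := rfl

/-- On the bimodule, `lt` multiplies from the left and `rt` from the right with a minus sign. The
cocycle pairs the `lt` of one argument with the `rt` of the other, so it vanishes on each of the two
summands alone. -/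
noncomputable instance : Bracket (PentExt k) (PentExt k) :=
  ⟨fun p q => PentExt.mk ⁅p.rt, q.rt⁆ ⁅p.lt, q.lt⁆
    (overlap (toAssoc k q.lt) (toAssoc k p.rt) - overlap (toAssoc k p.lt) (toAssoc k q.rt)
      + (toAssoc k p.lt * q.md - q.md * toAssoc k p.rt)
      - (toAssoc k q.lt * p.md - p.md * toAssoc k q.rt))⟩

@[simp] theorem PentExt.rt_lie (p q : PentExt k) : ⁅p, q⁆.rt = ⁅p.rt, q.rt⁆ := rfl

@[simp] theorem PentExt.lt_lie (p q : PentExt k) : ⁅p, q⁆.lt = ⁅p.lt, q.lt⁆ := rfl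

theorem PentExt.md_lie (p q : PentExt k) : ⁅p, q⁆.md =
    overlap (toAssoc k q.lt) (toAssoc k p.rt) - overlap (toAssoc k p.lt) (toAssoc k q.rt)
      + (toAssoc k p.lt * q.md - q.md * toAssoc k p.rt)
      - (toAssoc k q.lt * p.md - p.md * toAssoc k q.rt) := rfl

noncomputable instance : LieRing (PentExt k) where
  add_lie p q r := by
    ext
    · simp
    · simp
    · simp only [PentExt.md_lie, PentExt.md_add, PentExt.rt_add, PentExt.lt_add, map_add,
        overlap_add_left, overlap_add_right, mul_add, add_mul]
      abel
  lie_add p q r := by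
    ext
    · simp
    · simp
    · simp only [PentExt.md_lie, PentExt.md_add, PentExt.rt_add, PentExt.lt_add, map_add,
        overlap_add_left, overlap_add_right, mul_add, add_mul]
      abel
  lie_self p := by
    ext
    · simp
    · simp
    · simp only [PentExt.md_lie, PentExt.md_zero]
      abel
  leibniz_lie p q r := by
    ext
    · exact leibniz_lie p.rt q.rt r.rt
    · exact leibniz_lie p.lt q.lt r.lt
    -- Lie polynomials have augmentation 0, so the correction terms in the product rules for
    -- `overlap` vanish and the cocycle identity cancels formally.
    · simp only [PentExt.md_lie, PentExt.md_add, PentExt.rt_lie, PentExt.lt_lie, toAssoc_lie,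
        overlap_sub_left, overlap_sub_right, overlap_mul_left, overlap_mul_right, aug_toAssoc,
        zero_smul, add_zero, mul_add, add_mul, mul_sub, sub_mul, mul_assoc]
      abel

noncomputable instance : LieAlgebra k (PentExt k) where
  lie_smul c p q := by
    ext
    · simp
    · simp
    · simp only [PentExt.md_lie, PentExt.md_smul, PentExt.rt_smul, PentExt.lt_smul, map_smul,
        overlap_smul_left, overlap_smul_right, mul_smul_comm, smul_mul_assoc, smul_sub, smul_add]

/-- The images of the generators `t_{ij}`, `i < j`. -/
noncomputable def pentGen : Fin 4 → Fin 4 → PentExt k :=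
  -- The image of `t₁₂` is chosen so that the sum of all `t_{ij}`, `i < j`, which is central in
  -- `𝔱₄`, goes to 0.
  let a : PentExt k := PentExt.mk (-X k - Y k) (-X k - Y k) (-1)
  let b : PentExt k := PentExt.mk (X k) 0 0
  let c : PentExt k := PentExt.mk 0 (X k) 0
  let d : PentExt k := PentExt.mk (Y k) 0 0
  let e : PentExt k := PentExt.mk 0 (Y k) 0
  let f : PentExt k := PentExt.mk 0 0 1
  ![![0, a, b, c], ![a, 0, d, e], ![b, d, 0, f], ![c, e, f, 0]]

theorem pentGen_relator (r : FreeLieAlgebra k (Fin 4 × Fin 4)) (hr : DKRelator k 4 r) :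
    FreeLieAlgebra.lift k (fun p : Fin 4 × Fin 4 => pentGen (k := k) p.1 p.2) r = 0 := by
  cases hr with
  | symm i j =>
    rw [map_sub, FreeLieAlgebra.lift_of_apply, FreeLieAlgebra.lift_of_apply, sub_eq_zero]
    fin_cases i <;> fin_cases j <;> rfl
  | diag i =>
    rw [FreeLieAlgebra.lift_of_apply]
    fin_cases i <;> rfl
  | comm i j l m h₁ h₂ h₃ h₄ h₅ h₆ =>
    rw [LieHom.map_lie, FreeLieAlgebra.lift_of_apply, FreeLieAlgebra.lift_of_apply]
    fin_cases i <;> fin_cases j <;> first | exact absurd rfl h₁ | skip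
    all_goals fin_cases l <;> first | exact absurd rfl h₂ | exact absurd rfl h₄ | skip
    all_goals fin_cases m <;>
      first
        | exact absurd rfl h₃
        | exact absurd rfl h₅
        | exact absurd rfl h₆
        | (simp only [pentGen]
           ext <;> simp [PentExt.md_lie, overlap_gen_gen])
  | fourTerm i j l h₁ h₂ h₃ =>
    have hs : ⁅Y k, X k⁆ = -⁅X k, Y k⁆ := (lie_skew _ _).symm
    rw [LieHom.map_lie, map_add, FreeLieAlgebra.lift_of_apply, FreeLieAlgebra.lift_of_apply,
      FreeLieAlgebra.lift_of_apply]
    fin_cases i <;> fin_cases j <;> first | exact absurd rfl h₁ | skip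
    all_goals fin_cases l <;>
      first
        | exact absurd rfl h₂
        | exact absurd rfl h₃
        | (simp only [pentGen]
           ext <;> simp [PentExt.md_lie, overlap_gen_gen] <;> (try rw [hs]) <;> abel)

/-- The morphism from `𝔱₄` to the extension. -/
noncomputable def pentHom : DK k 4 →ₗ⁅k⁆ PentExt k :=
  DK.lift (FreeLieAlgebra.lift k fun p : Fin 4 × Fin 4 => pentGen p.1 p.2) pentGen_relator

theorem pentHom_t (i j : Fin 4) : pentHom (t k i j) = pentGen i j := by
  rw [pentHom, DK.lift_t, FreeLieAlgebra.lift_of_apply]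

end PentExt

/-! ### The value of the pentagon in the extension -/

section PentValue

open FreeAlgebra (ι)

attribute [local instance 100] LieRing.ofAssociativeRing

variable {k : Type u} [Field k]

/-- The coefficient of the first generator in a Lie polynomial. -/
noncomputable def coeffX : L₂ k →ₗ⁅k⁆ k := subst 1 0

@[simp] theorem coeffX_X : coeffX (X k) = 1 := FreeLieAlgebra.lift_of_apply _ _

@[simp] theorem coeffX_Y : coeffX (Y k) = 0 := FreeLieAlgebra.lift_of_apply _ _

@[simp] theorem coeffX_lie (z w : L₂ k) : coeffX ⁅z, w⁆ = 0 := by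
  rw [LieHom.map_lie, LieRing.of_associative_ring_bracket, mul_comm, sub_self]

theorem coeffX_eq_zero {φ : L₂ k} (hφ : φ ∈ degreeGE k 2) : coeffX φ = 0 := by
  have := subst_eq_zero (1 : k) 1 0 hφ
  rwa [one_smul, zero_smul] at this

theorem subst_of_zero {L : Type u} [LieRing L] [LieAlgebra k L] (a b : L) :
    subst a b (FreeLieAlgebra.of k 0) = a := FreeLieAlgebra.lift_of_apply _ _

theorem subst_of_one {L : Type u} [LieRing L] [LieAlgebra k L] (a b : L) :
    subst a b (FreeLieAlgebra.of k 1) = b := FreeLieAlgebra.lift_of_apply _ _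

@[simp] theorem subst_X {L : Type u} [LieRing L] [LieAlgebra k L] (a b : L) :
    subst a b (X k) = a := subst_of_zero a b

@[simp] theorem subst_Y {L : Type u} [LieRing L] [LieAlgebra k L] (a b : L) :
    subst a b (Y k) = b := subst_of_one a b

theorem eq_subst {L : Type u} [LieRing L] [LieAlgebra k L] (F : L₂ k →ₗ⁅k⁆ L) (z : L₂ k) :
    subst (F (X k)) (F (Y k)) z = F z := by
  have h : F = subst (F (X k)) (F (Y k)) := by
    apply FreeLieAlgebra.hom_ext
    intro i
    fin_cases i
    · exact (subst_of_zero _ _).symm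
    · exact (subst_of_one _ _).symm
  exact (LieHom.congr_fun h z).symm

/-- A summand that commutes with both arguments can enter only through the linear part of `φ`, which
is absent. -/
theorem subst_add_of_commute {L : Type u} [LieRing L] [LieAlgebra k L] {a b c : L}
    (ha : ⁅c, a⁆ = 0) (hb : ⁅c, b⁆ = 0) {φ : L₂ k} (hφ : φ ∈ degreeGE k 2) :
    subst (a + c) b φ = subst a b φ := by
  have key : ∀ z : L₂ k, ⁅c, subst a b z⁆ = 0 ∧
      subst (a + c) b z = subst a b z + coeffX z • c := by
    intro z
    induction z using lie_induction with
    | gen i =>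
      fin_cases i
      · exact ⟨by simpa [subst_of_zero] using ha,
          by change subst _ _ (X k) = subst _ _ (X k) + coeffX (X k) • c; simp⟩
      · exact ⟨by simpa [subst_of_one] using hb,
          by change subst _ _ (Y k) = subst _ _ (Y k) + coeffX (Y k) • c; simp⟩
    | lie z w hz hw =>
      have hz' : ⁅subst a b z, c⁆ = 0 := by rw [← lie_skew, hz.1, neg_zero]
      constructor
      · rw [LieHom.map_lie, leibniz_lie, hz.1, hw.1, zero_lie, lie_zero, add_zero]
      · rw [LieHom.map_lie, LieHom.map_lie, hz.2, hw.2, coeffX_lie]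
        simp [hz', hw.1]
    | add z w hz hw =>
      refine ⟨by rw [map_add, lie_add, hz.1, hw.1, add_zero], ?_⟩
      rw [map_add, map_add, map_add, hz.2, hw.2, add_smul]
      abel
    | smul r z hz =>
      refine ⟨by rw [map_smul, lie_smul, hz.1, smul_zero], ?_⟩
      rw [map_smul, map_smul, map_smul, hz.2, smul_add, smul_assoc]
    | zero => simp
  rw [(key φ).2, coeffX_eq_zero hφ, zero_smul, add_zero]

/-- The algebra morphism to polynomials that keeps only the powers of the `i`-th generator. -/
noncomputable def toPoly (i : Fin 2) : Assoc k →ₐ[k] Polynomial k :=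
  FreeAlgebra.lift k fun j => if j = i then Polynomial.X else 0

@[simp] theorem toPoly_gen (i j : Fin 2) :
    toPoly i (ι k j) = if j = i then Polynomial.X else 0 := by
  rw [toPoly, FreeAlgebra.lift_ι_apply]

theorem toPoly_toAssoc (z : L₂ k) :
    toPoly 0 (toAssoc k z) = coeffX z • (Polynomial.X : Polynomial k) := by
  induction z using lie_induction with
  | gen i =>
    fin_cases i
    · change _ = coeffX (X k) • _; simp
    · change _ = coeffX (Y k) • _; simp
  | lie z w _ _ => rw [toAssoc_lie, map_sub, map_mul, map_mul, mul_comm, sub_self, coeffX_lie,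
    zero_smul]
  | add z w hz hw => rw [map_add, map_add, map_add, hz, hw, add_smul]
  | smul r z hz => rw [map_smul, map_smul, map_smul, hz, smul_assoc]
  | zero => simp

/-- The polynomial `∑ c_n T^n`, where `c_n` is the coefficient of the word `y xⁿ`. -/
noncomputable def depthOne : L₂ k →ₗ[k] Polynomial k :=
  (toPoly 0).toLinearMap ∘ₗ stripLeft k 1 ∘ₗ (toAssoc k : L₂ k →ₗ[k] Assoc k)

theorem depthOne_apply (z : L₂ k) : depthOne z = toPoly 0 (stripLeft k 1 (toAssoc k z)) := rfl

theorem depthOne_X : depthOne (X k) = 0 := by simp [depthOne_apply, stripLeft_gen]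

theorem depthOne_Y : depthOne (Y k) = 1 := by simp [depthOne_apply, stripLeft_gen]

/-- A word `y xⁿ` in a product of Lie polynomials takes its `y` from the first factor and a power of
`x` from the second; the only power of `x` in a Lie polynomial is its linear term. -/
theorem depthOne_lie (z w : L₂ k) : depthOne ⁅z, w⁆
    = coeffX w • (depthOne z * Polynomial.X) - coeffX z • (depthOne w * Polynomial.X) := by
  simp only [depthOne_apply, toAssoc_lie, map_sub, stripLeft_mul, aug_toAssoc, zero_smul, add_zero,
    map_mul, toPoly_toAssoc, mul_smul_comm]

/-- The morphism `x ↦ t₁₃ + t₁₄ + t₃₄`, `y ↦ t₂₃ + t₂₄`. -/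
noncomputable def doublingHom : L₂ k →ₗ⁅k⁆ PentExt k where
  toFun z := PentExt.mk z z (algebraMap k _ (coeffX z) - merge (toAssoc k z))
  map_add' z w := by
    ext
    · rfl
    · rfl
    · simp only [PentExt.md_mk, PentExt.md_add, map_add]; abel
  map_smul' c z := by
    ext
    · rfl
    · rfl
    · simp [PentExt.md_mk, PentExt.md_smul, map_smul, smul_sub, Algebra.algebraMap_eq_smul_one,
        smul_smul]
  -- On the diagonal the cocycle is the coboundary of `-merge`, by `merge_mul`. The scalar `coeffX`
  -- is central in the bimodule; it vanishes on brackets and adjusts the value at `x` to contain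
  -- `t₃₄`.
  map_lie' := fun {z w} => by
    ext
    · rfl
    · rfl
    · simp only [PentExt.md_mk, PentExt.md_lie, PentExt.rt_mk, PentExt.lt_mk, toAssoc_lie, map_sub,
        merge_mul, coeffX_lie, map_zero, mul_sub, sub_mul,
        (Algebra.commutes (coeffX _) (toAssoc k _))]
      abel

/-- The morphism `x ↦ t₁₄`, `y ↦ t₂₄ + t₃₄`. -/
noncomputable def stripHom : L₂ k →ₗ⁅k⁆ PentExt k where
  toFun z := PentExt.mk 0 z (stripRight 1 (toAssoc k z))
  map_add' z w := by
    ext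
    · simp
    · rfl
    · simp
  map_smul' c z := by
    ext
    · simp
    · rfl
    · simp
  -- With `rt = 0` there is no cocycle and only the left action remains, so the middle component
  -- must be a Fox derivative, as `stripRight 1` is on Lie polynomials.
  map_lie' := fun {z w} => by
    ext
    · simp
    · rfl
    · simp [-LieHom.map_lie, PentExt.md_lie, toAssoc_lie, stripRight_mul]

/-- The morphism `x ↦ p(t₁₃, t₂₃)`, `y ↦ t₃₄`. -/
noncomputable def depthOneHom (p : L₂ k) : L₂ k →ₗ⁅k⁆ PentExt k where
  toFun z := PentExt.mk (coeffX z • p) 0 (Polynomial.aeval (toAssoc k p) (depthOne z))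
  map_add' z w := by
    ext
    · simp [add_smul]
    · simp
    · simp
  map_smul' c z := by
    ext
    · simp [smul_smul]
    · simp
    · simp
  -- With `lt = 0` only right multiplication by `coeffX z • p` remains; this is the recursion
  -- `depthOne_lie` evaluated at `p`.
  map_lie' := fun {z w} => by
    ext
    · simp
    · simp
    · simp [PentExt.md_lie, depthOne_lie]
      abel

/-- The morphism `z ↦ z(t₁₃, t₂₃)`. -/
noncomputable def rightHom : L₂ k →ₗ⁅k⁆ PentExt k where
  toFun z := PentExt.mk z 0 0
  map_add' z w := by ext <;> simp
  map_smul' c z := by ext <;> simp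
  map_lie' := fun {z w} => by ext <;> simp [PentExt.md_lie]

/-- Each of the five substitutions is a value of an explicit morphism `𝕃(x, y) → PentExt`. Before
the signs, the middle components are, in the order of the pentagon: 0, `stripRight 1 b`, `F(y)`,
`F(x+y)`, `-merge b`. -/
theorem pentHom_pentagon_md {φ : L₂ k} (hφ : φ ∈ degreeGE k 2) :
    (pentHom (pentagon φ)).md
      = stripRight 1 (toAssoc k (subst (-X k - Y k) (Y k) φ))
        + merge (toAssoc k (subst (-X k - Y k) (Y k) φ))
        + Polynomial.aeval (ι k 1) (depthOne φ)
        - Polynomial.aeval (ι k 0 + ι k 1) (depthOne φ) := by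
  set b := subst (-X k - Y k) (Y k) φ with hb
  have h1 : subst (pentHom (t k 0 1)) (pentHom (t k 1 2)) φ = rightHom b := by
    -- The second summand commutes with both arguments of the `rightHom` substitution, so it drops
    -- out. The same device removes `(-y, 0, 0)` from the next term.
    have e : pentHom (t k 0 1) = rightHom (-X k - Y k) + PentExt.mk 0 (-X k - Y k) (-1) := by
      rw [pentHom_t]
      ext <;> simp [pentGen, rightHom]
    have e' : pentHom (t k 1 2) = rightHom (Y k) := by
      rw [pentHom_t]; rfl
    rw [e, e', subst_add_of_commute _ _ hφ, hb, map_subst]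
    · ext <;> simp [rightHom, PentExt.md_lie, overlap_gen_gen]
      abel
    · ext <;> simp [rightHom, PentExt.md_lie, overlap_gen_gen]
  have h2 : subst (pentHom (t k 0 1) + pentHom (t k 0 2)) (pentHom (t k 1 3) + pentHom (t k 2 3)) φ
      = stripHom b := by
    have e : pentHom (t k 0 1) + pentHom (t k 0 2)
        = stripHom (-X k - Y k) + PentExt.mk (-Y k) 0 0 := by
      rw [pentHom_t, pentHom_t]
      ext <;> simp [pentGen, stripHom, stripRight_gen]
      abel
    have e' : pentHom (t k 1 3) + pentHom (t k 2 3) = stripHom (Y k) := by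
      rw [pentHom_t, pentHom_t]
      ext <;> simp [pentGen, stripHom, stripRight_gen]
    rw [e, e', subst_add_of_commute _ _ hφ, hb, map_subst]
    · ext <;> simp [stripHom, PentExt.md_lie, overlap_gen_gen, stripRight_gen]
    · ext <;> simp [stripHom, PentExt.md_lie, overlap_gen_gen, stripRight_gen]
  have h3 : subst (pentHom (t k 1 2)) (pentHom (t k 2 3)) φ = depthOneHom (Y k) φ := by
    rw [← eq_subst (depthOneHom (Y k)) φ]
    congr 2 <;> rw [pentHom_t] <;> ext <;> simp [pentGen, depthOneHom, depthOne_X, depthOne_Y]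
  have h4 : subst (pentHom (t k 0 2) + pentHom (t k 1 2)) (pentHom (t k 2 3)) φ
      = depthOneHom (X k + Y k) φ := by
    rw [← eq_subst (depthOneHom (X k + Y k)) φ]
    congr 2 <;> simp only [pentHom_t] <;> ext <;>
      simp [pentGen, depthOneHom, depthOne_X, depthOne_Y]
  have h5 : subst (pentHom (t k 0 1)) (pentHom (t k 1 2) + pentHom (t k 1 3)) φ
      = doublingHom b := by
    rw [hb, map_subst]
    congr 2 <;> simp only [pentHom_t] <;> ext <;> simp [pentGen, doublingHom, merge_gen]
  have hc : coeffX b = 0 := by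
    rw [hb, map_subst]
    simpa using subst_eq_zero (1 : k) (-1) 0 hφ
  rw [pentagon_eq]
  simp only [map_add, map_sub, map_subst]
  rw [h1, h2, h3, h4, h5]
  simp [rightHom, stripHom, depthOneHom, doublingHom, hc]
  abel

end PentValue

/-! ### The abelianization of the Brunnian Lie algebra -/

section Brunnian

open FreeAlgebra (ι)

attribute [local instance 100] LieRing.ofAssociativeRing

variable {k : Type u} [Field k]

theorem DK.induction {n : ℕ} {P : DK k n → Prop} (gen : ∀ i j, P (t k i j))
    (lie : ∀ p q, P p → P q → P ⁅p, q⁆) (add : ∀ p q, P p → P q → P (p + q))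
    (smul : ∀ (c : k) p, P p → P (c • p)) (zero : P 0) (p : DK k n) : P p := by
  obtain ⟨z, rfl⟩ := LieSubmodule.Quotient.surjective_mk' _ p
  induction z using lie_induction with
  | gen i => exact gen i.1 i.2
  | lie z w hz hw => exact lie _ _ hz hw
  | add z w hz hw => exact add _ _ hz hw
  | smul c z hz => exact smul c _ hz
  | zero => exact zero

theorem t_self {n : ℕ} (i : Fin n) : t k i i = 0 := mk_relator k (DKRelator.diag i)

theorem lie_t {n : ℕ} {i j l : Fin n} (h₁ : i ≠ j) (h₂ : i ≠ l) (h₃ : j ≠ l) :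
    ⁅t k i j, t k i l⁆ = ⁅t k i l, t k j l⁆ := by
  have h := t_fourTerm k h₂ h₁ h₃.symm
  rw [lie_add, t_symm k l j] at h
  rw [← lie_skew, eq_neg_of_add_eq_zero_left h, neg_neg]

/-- The adjoint action of words in `t₁₄` and `t₂₄`. -/
noncomputable def strandAct : Assoc k →ₐ[k] Module.End k (DK k 4) :=
  FreeAlgebra.lift k fun i => (LieAlgebra.ad k (DK k 4) (![t k 0 3, t k 1 3] i) : Module.End k _)

/-- The elements `ad_w(t₃₄)` for words `w` in `t₁₄` and `t₂₄`. -/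
noncomputable def brunWord : Assoc k →ₗ[k] DK k 4 :=
  LinearMap.applyₗ (t k 2 3) ∘ₗ strandAct.toLinearMap

theorem brunWord_apply (a : Assoc k) : brunWord a = strandAct a (t k 2 3) := rfl

theorem brunWord_one : brunWord (1 : Assoc k) = t k 2 3 := by
  rw [brunWord_apply, map_one]; rfl

theorem brunWord_gen_mul (i : Fin 2) (a : Assoc k) :
    brunWord (ι k i * a) = ⁅(![t k 0 3, t k 1 3] : Fin 2 → DK k 4) i, brunWord a⁆ := by
  rw [brunWord_apply, map_mul, Module.End.mul_apply, strandAct, FreeAlgebra.lift_ι_apply]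
  rfl

theorem brunWord_gen (i : Fin 2) :
    brunWord (ι k i) = ⁅(![t k 0 3, t k 1 3] : Fin 2 → DK k 4) i, t k 2 3⁆ := by
  rw [← brunWord_one, ← brunWord_gen_mul, mul_one]

/-- The morphism `x ↦ t₁₄`, `y ↦ t₂₄`. -/
noncomputable abbrev strandHom : L₂ k →ₗ⁅k⁆ DK k 4 := subst (t k 0 3) (t k 1 3)

theorem strandHom_of (i : Fin 2) : strandHom (FreeLieAlgebra.of k i) = ![t k 0 3, t k 1 3] i :=
  FreeLieAlgebra.lift_of_apply _ _

theorem lie_strandHom (z : L₂ k) (p : DK k 4) : ⁅strandHom z, p⁆ = strandAct (toAssoc k z) p := by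
  induction z using lie_induction generalizing p with
  | gen i => rw [strandHom_of, toAssoc_of, strandAct, FreeAlgebra.lift_ι_apply]; rfl
  | lie z w hz hw =>
    rw [LieHom.map_lie, lie_lie, hz, hw, hw, hz, toAssoc_lie, map_sub, map_mul, map_mul]; rfl
  | add z w hz hw => rw [map_add, add_lie, hz, hw, map_add, map_add]; rfl
  | smul c z hz => rw [map_smul, smul_lie, hz, map_smul, map_smul]; rfl
  | zero => simp

theorem lie_strandHom_brunWord (z : L₂ k) (a : Assoc k) :
    ⁅strandHom z, brunWord a⁆ = brunWord (toAssoc k z * a) := by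
  rw [lie_strandHom, brunWord_apply, brunWord_apply, map_mul]; rfl

theorem t_mem_brun : t k 2 3 ∈ brun₂₂ k := by
  rw [brun₂₂, LieSubmodule.mem_inf, LieHom.mem_ker, LieHom.mem_ker]
  exact ⟨pr_t_left 2 3, pr_t_right 3 2⟩

theorem brunWord_mem (a : Assoc k) : brunWord a ∈ brun₂₂ k := by
  induction a using assoc_induction with
  | one => rw [brunWord_one]; exact t_mem_brun
  | gen_mul i a ha => rw [brunWord_gen_mul]; exact lie_mem_right k _ _ _ _ ha
  | add a b ha hb => rw [map_add]; exact add_mem ha hb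
  | smul c a ha => rw [map_smul]; exact SMulMemClass.smul_mem c ha

variable (k) in
/-- The span of the `ad_w(t₃₄)` and of the commutators in the Brunnian Lie algebra. -/
noncomputable def brunSpan : Submodule k (DK k 4) :=
  LinearMap.range brunWord ⊔ (⁅brun₂₂ k, brun₂₂ k⁆ : LieIdeal k (DK k 4)).toSubmodule

variable (k) in
/-- The span of the Lie algebra generated by `t₁₄`, `t₂₄` and of `brunSpan`. -/
noncomputable def strandSpan : Submodule k (DK k 4) :=
  LinearMap.range ((strandHom : L₂ k →ₗ⁅k⁆ DK k 4) : L₂ k →ₗ[k] DK k 4) ⊔ brunSpan k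

theorem brunWord_mem_span (a : Assoc k) : brunWord a ∈ brunSpan k :=
  Submodule.mem_sup_left ⟨a, rfl⟩

theorem commutator_mem_span {p : DK k 4} (hp : p ∈ (⁅brun₂₂ k, brun₂₂ k⁆ : LieIdeal k (DK k 4))) :
    p ∈ brunSpan k :=
  Submodule.mem_sup_right hp

theorem brunSpan_le_strandSpan : brunSpan k ≤ strandSpan k := le_sup_right

theorem strandHom_mem (z : L₂ k) : strandHom z ∈ strandSpan k := Submodule.mem_sup_left ⟨z, rfl⟩

theorem brunSpan_le {p : DK k 4} (hp : p ∈ brunSpan k) : p ∈ brun₂₂ k := by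
  obtain ⟨_, ⟨a, rfl⟩, q, hq, rfl⟩ := Submodule.mem_sup.mp hp
  exact add_mem (brunWord_mem a) (LieSubmodule.lie_le_right _ _ hq)

theorem lie_brunSpan {p q : DK k 4} (hp : p ∈ brunSpan k) (hq : q ∈ brunSpan k) :
    ⁅p, q⁆ ∈ brunSpan k :=
  commutator_mem_span (LieSubmodule.lie_mem_lie (brunSpan_le hp) (brunSpan_le hq))

theorem lie_strandHom_mem (z : L₂ k) {p : DK k 4} (hp : p ∈ brunSpan k) :
    ⁅strandHom z, p⁆ ∈ brunSpan k := by
  obtain ⟨_, ⟨a, rfl⟩, q, hq, rfl⟩ := Submodule.mem_sup.mp hp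
  rw [lie_add, lie_strandHom_brunWord]
  exact add_mem (brunWord_mem_span _) (commutator_mem_span (lie_mem_right k _ _ _ _ hq))

theorem lie_strandSpan_brunSpan {p q : DK k 4} (hp : p ∈ strandSpan k) (hq : q ∈ brunSpan k) :
    ⁅p, q⁆ ∈ brunSpan k := by
  obtain ⟨_, ⟨z, rfl⟩, p', hp', rfl⟩ := Submodule.mem_sup.mp hp
  rw [add_lie]
  exact add_mem (lie_strandHom_mem z hq) (lie_brunSpan hp' hq)

theorem lie_strandSpan {p q : DK k 4} (hp : p ∈ strandSpan k) (hq : q ∈ strandSpan k) :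
    ⁅p, q⁆ ∈ strandSpan k := by
  obtain ⟨_, ⟨z, rfl⟩, q', hq', rfl⟩ := Submodule.mem_sup.mp hq
  rw [lie_add]
  refine add_mem ?_ (brunSpan_le_strandSpan (lie_strandSpan_brunSpan hp hq'))
  obtain ⟨_, ⟨w, rfl⟩, p', hp', rfl⟩ := Submodule.mem_sup.mp hp
  rw [add_lie]
  refine add_mem ?_ ?_
  · change ⁅strandHom w, strandHom z⁆ ∈ _
    rw [← LieHom.map_lie]
    exact strandHom_mem _
  · rw [← lie_skew]
    exact neg_mem (brunSpan_le_strandSpan (lie_strandHom_mem z hp'))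

/-- As `ad p` is a derivation, it suffices to test `t₁₄`, `t₂₄`, `t₃₄`. The stronger condition on
`t₃₄` keeps all `ad_w(t₃₄)` inside `brunSpan`. -/
theorem lie_mem_strandSpan {p : DK k 4}
    (h : ∀ i : Fin 2, ⁅p, (![t k 0 3, t k 1 3] : Fin 2 → DK k 4) i⁆ ∈ strandSpan k)
    (hz : ⁅p, t k 2 3⁆ ∈ brunSpan k) {q : DK k 4} (hq : q ∈ strandSpan k) :
    ⁅p, q⁆ ∈ strandSpan k := by
  have h1 : ∀ z : L₂ k, ⁅p, strandHom z⁆ ∈ strandSpan k := fun z => by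
    induction z using lie_induction with
    | gen i => rw [strandHom_of]; exact h i
    | lie z w hz hw =>
      rw [LieHom.map_lie, leibniz_lie]
      exact add_mem (lie_strandSpan hz (strandHom_mem w)) (lie_strandSpan (strandHom_mem z) hw)
    | add z w hz hw => rw [map_add, lie_add]; exact add_mem hz hw
    | smul c z hz => rw [map_smul, lie_smul]; exact Submodule.smul_mem _ c hz
    | zero => simp
  have h2 : ∀ a : Assoc k, ⁅p, brunWord a⁆ ∈ brunSpan k := fun a => by
    induction a using assoc_induction with
    | one => rw [brunWord_one]; exact hz
    | gen_mul i a ha =>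
      rw [brunWord_gen_mul, leibniz_lie]
      refine add_mem (lie_strandSpan_brunSpan (h i) (brunWord_mem_span a)) ?_
      rw [← strandHom_of]
      exact lie_strandHom_mem _ ha
    | add a b ha hb => rw [map_add, lie_add]; exact add_mem ha hb
    | smul c a ha => rw [map_smul, lie_smul]; exact Submodule.smul_mem _ c ha
  obtain ⟨_, ⟨z, rfl⟩, q', hq', rfl⟩ := Submodule.mem_sup.mp hq
  obtain ⟨_, ⟨a, rfl⟩, r, hr, rfl⟩ := Submodule.mem_sup.mp hq'
  rw [lie_add, lie_add]
  exact add_mem (h1 z) (brunSpan_le_strandSpan (add_mem (h2 a)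
    (commutator_mem_span (lie_mem_right k _ _ _ _ hr))))

theorem t_mem_strandSpan (i : Fin 3) : t k i.castSucc 3 ∈ strandSpan k := by
  fin_cases i
  · exact (strandHom_of (k := k) 0 ▸ strandHom_mem _ : ![t k 0 3, t k 1 3] 0 ∈ strandSpan k)
  · exact (strandHom_of (k := k) 1 ▸ strandHom_mem _ : ![t k 0 3, t k 1 3] 1 ∈ strandSpan k)
  · exact brunSpan_le_strandSpan (brunWord_one (k := k) ▸ brunWord_mem_span 1)

theorem brunWord_gen_zero_mem : ⁅t k (0 : Fin 4) 3, t k 2 3⁆ ∈ brunSpan k :=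
  brunWord_gen (k := k) 0 ▸ brunWord_mem_span _

theorem brunWord_gen_one_mem : ⁅t k (1 : Fin 4) 3, t k 2 3⁆ ∈ brunSpan k :=
  brunWord_gen (k := k) 1 ▸ brunWord_mem_span _

/-- The four-term relations turn brackets of `t₁₂`, `t₁₃`, `t₂₃` with the `t_{i4}` into 0 or
brackets of the `t_{i4}` among themselves. Hence `strandSpan` is an ideal. -/
theorem lie_t_mem_strandSpan {i j : Fin 4} (hij : i < j) {q : DK k 4} (hq : q ∈ strandSpan k) :
    ⁅t k i j, q⁆ ∈ strandSpan k := by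
  by_cases hj : j = 3
  · subst hj
    obtain ⟨i, rfl⟩ := Fin.eq_castSucc_of_ne_last (x := i) (ne_of_lt hij)
    exact lie_strandSpan (t_mem_strandSpan i) hq
  have h3 : t k 0 3 ∈ strandSpan k := t_mem_strandSpan 0
  have h4 : t k 1 3 ∈ strandSpan k := t_mem_strandSpan 1
  have hcases : (i = 0 ∧ j = 1) ∨ (i = 0 ∧ j = 2) ∨ (i = 1 ∧ j = 2) := by omega
  rcases hcases with ⟨rfl, rfl⟩ | ⟨rfl, rfl⟩ | ⟨rfl, rfl⟩
  · refine lie_mem_strandSpan (fun i => ?_) ?_ hq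
    · fin_cases i
      · change ⁅t k 0 1, t k 0 3⁆ ∈ _
        rw [lie_t (by decide) (by decide) (by decide)]
        exact lie_strandSpan h3 h4
      · change ⁅t k 0 1, t k 1 3⁆ ∈ _
        rw [t_symm k 0 1, lie_t (by decide) (by decide) (by decide)]
        exact lie_strandSpan h4 h3
    · rw [t_comm k (by decide) (by decide) (by decide) (by decide) (by decide) (by decide)]
      exact zero_mem _
  · refine lie_mem_strandSpan (fun i => ?_) ?_ hq
    · fin_cases i
      · change ⁅t k 0 2, t k 0 3⁆ ∈ _
        rw [lie_t (by decide) (by decide) (by decide)]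
        exact brunSpan_le_strandSpan brunWord_gen_zero_mem
      · change ⁅t k 0 2, t k 1 3⁆ ∈ _
        rw [t_comm k (by decide) (by decide) (by decide) (by decide) (by decide) (by decide)]
        exact zero_mem _
    · rw [t_symm k 0 2, lie_t (by decide) (by decide) (by decide), ← lie_skew]
      exact neg_mem brunWord_gen_zero_mem
  · refine lie_mem_strandSpan (fun i => ?_) ?_ hq
    · fin_cases i
      · change ⁅t k 1 2, t k 0 3⁆ ∈ _
        rw [t_comm k (by decide) (by decide) (by decide) (by decide) (by decide) (by decide)]
        exact zero_mem _
      · change ⁅t k 1 2, t k 1 3⁆ ∈ _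
        rw [lie_t (by decide) (by decide) (by decide)]
        exact brunSpan_le_strandSpan brunWord_gen_one_mem
    · rw [t_symm k 1 2, lie_t (by decide) (by decide) (by decide), ← lie_skew]
      exact neg_mem brunWord_gen_one_mem

theorem lie_mem_strandSpan_right (p : DK k 4) {q : DK k 4} (hq : q ∈ strandSpan k) :
    ⁅p, q⁆ ∈ strandSpan k := by
  induction p using DK.induction generalizing q with
  | gen i j =>
    rcases lt_trichotomy i j with h | rfl | h
    · exact lie_t_mem_strandSpan h hq
    · rw [t_self, zero_lie]; exact zero_mem _
    · rw [t_symm]; exact lie_t_mem_strandSpan h hq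
  | lie p p' hp hp' => rw [lie_lie]; exact sub_mem (hp (hp' hq)) (hp' (hp hq))
  | add p p' hp hp' => rw [add_lie]; exact add_mem (hp hq) (hp' hq)
  | smul c p hp => rw [smul_lie]; exact Submodule.smul_mem _ c (hp hq)
  | zero => rw [zero_lie]; exact zero_mem _

/-- Adding a free fourth strand is a section of `pr⁴`. Modulo the ideal `strandSpan`, which contains
every `t_{i4}`, each generator equals the section of its projection, and this property passes to
brackets. -/
theorem sub_cable_pr_mem (p : DK k 4) :
    p - cable k ![some 0, some 1, some 2, none] (pr k 3 p) ∈ strandSpan k := by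
  induction p using DK.induction with
  | gen i j =>
    by_cases hi : i = 3
    · subst hi
      rw [pr_t_left, map_zero, sub_zero]
      by_cases hj : j = 3
      · rw [hj, t_self]; exact zero_mem _
      · obtain ⟨j, rfl⟩ := Fin.eq_castSucc_of_ne_last (x := j) hj
        rw [t_symm]
        exact t_mem_strandSpan j
    by_cases hj : j = 3
    · subst hj
      rw [pr_t_right, map_zero, sub_zero]
      obtain ⟨i, rfl⟩ := Fin.eq_castSucc_of_ne_last (x := i) hi
      exact t_mem_strandSpan i
    obtain ⟨i, rfl⟩ := Fin.eq_castSucc_of_ne_last (x := i) hi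
    obtain ⟨j, rfl⟩ := Fin.eq_castSucc_of_ne_last (x := j) hj
    by_cases hij : i = j
    · rw [hij, t_self]; simp
    · have := pr_t (k := k) 3 i j hij
      have e : ∀ a : Fin 3, (3 : Fin 4).succAbove a = a.castSucc := by decide
      rw [e, e] at this
      rw [this, cable_t, cableGen, if_neg hij]
      revert hij
      fin_cases i <;> fin_cases j <;> simp [Finset.sum_filter, Fin.sum_univ_four]
  | lie p q hp hq =>
    set s := cable k ![some (0 : Fin 3), some 1, some 2, none]
    have : ⁅p, q⁆ - s (pr k 3 ⁅p, q⁆)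
        = ⁅s (pr k 3 p), q - s (pr k 3 q)⁆ - ⁅q, p - s (pr k 3 p)⁆ := by
      rw [LieHom.map_lie, LieHom.map_lie, lie_sub, lie_sub, ← lie_skew q p, ← lie_skew q (s _)]
      abel
    rw [this]
    exact sub_mem (lie_mem_strandSpan_right _ hq) (lie_mem_strandSpan_right _ hp)
  | add p q hp hq => rw [map_add, map_add, add_sub_add_comm]; exact add_mem hp hq
  | smul c p hp => rw [map_smul, map_smul, ← smul_sub]; exact Submodule.smul_mem _ c hp
  | zero => simp

/-- Vanishing under `pr⁴` puts `p` in `strandSpan`; vanishing under `pr³` then removes its component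
in the Lie algebra generated by `t₁₄` and `t₂₄`. -/
theorem mem_brunSpan {p : DK k 4} (hp : p ∈ brun₂₂ k) : p ∈ brunSpan k := by
  rw [brun₂₂, LieSubmodule.mem_inf, LieHom.mem_ker, LieHom.mem_ker] at hp
  have h := sub_cable_pr_mem p
  rw [hp.2, map_zero, sub_zero] at h
  obtain ⟨_, ⟨z, rfl⟩, q, hq, rfl⟩ := Submodule.mem_sup.mp h
  have hq' := brunSpan_le hq
  rw [brun₂₂, LieSubmodule.mem_inf, LieHom.mem_ker, LieHom.mem_ker] at hq'
  have h1 : pr k 2 (strandHom z) = 0 := by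
    have := hp.1
    rw [map_add, hq'.1, add_zero] at this
    exact this
  -- Reinserting strand 3 restores `t₁₄` and `t₂₄`, so `pr³` is injective on the Lie algebra they
  -- generate.
  have h2 : cable k ![some (0 : Fin 3), some 1, none, some 2] (pr k 2 (strandHom z))
      = strandHom z := by
    have e1 : pr k 2 (t k 0 3) = t k (0 : Fin 3) 2 := pr_t 2 0 2 (by decide)
    have e2 : pr k 2 (t k 1 3) = t k (1 : Fin 3) 2 := pr_t 2 1 2 (by decide)
    rw [map_subst, map_subst, e1, e2, cable_t, cable_t]
    congr 2 <;> simp [cableGen, Finset.sum_filter, Fin.sum_univ_four]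
  rw [h1, map_zero] at h2
  change strandHom z + q ∈ _
  rwa [← h2, zero_add]

/-- Since `t₁₄`, `t₂₄` act on the bimodule by left multiplication, `pentHom` inverts `brunWord`;
with `pentHom_commutator`, the `ad_w(t₃₄)` are independent modulo commutators. -/
theorem pentHom_brunWord (a : Assoc k) : pentHom (brunWord a) = PentExt.mk 0 0 a := by
  induction a using assoc_induction with
  | one => rw [brunWord_one, pentHom_t]; rfl
  | gen_mul i a ha =>
    rw [brunWord_gen_mul, LieHom.map_lie, ha]
    fin_cases i
    · change ⁅pentHom (t k 0 3), _⁆ = _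
      rw [pentHom_t]
      ext <;> simp [pentGen, PentExt.md_lie]
    · change ⁅pentHom (t k 1 3), _⁆ = _
      rw [pentHom_t]
      ext <;> simp [pentGen, PentExt.md_lie]
  | add a b ha hb => rw [map_add, map_add, ha, hb]; ext <;> simp
  | smul c a ha => rw [map_smul, map_smul, ha]; ext <;> simp

/-- The component `rt` kills every `t_{i4}`, so it factors through `pr⁴`; likewise `lt` below
factors through `pr³`. -/
theorem pentHom_cable_pr_rt (p : DK k 4) :
    (pentHom (cable k ![some (0 : Fin 3), some 1, some 2, none] (pr k 3 p))).rt
      = (pentHom p).rt := by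
  induction p using DK.induction with
  | gen i j =>
    rw [pr, cable_t, cableGen]
    fin_cases i <;> fin_cases j <;>
      simp [Finset.sum_filter, Fin.sum_univ_four, Fin.sum_univ_three, Fin.succAbove, Fin.lt_def,
        cable_t, cableGen, pentHom_t, pentGen]
  | lie p q hp hq => simp only [LieHom.map_lie, PentExt.rt_lie, hp, hq]
  | add p q hp hq => simp only [map_add, PentExt.rt_add, hp, hq]
  | smul c p hp => simp only [map_smul, PentExt.rt_smul, hp]
  | zero => simp

theorem pentHom_cable_pr_lt (p : DK k 4) :
    (pentHom (cable k ![some (0 : Fin 3), some 1, none, some 2] (pr k 2 p))).lt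
      = (pentHom p).lt := by
  induction p using DK.induction with
  | gen i j =>
    rw [pr, cable_t, cableGen]
    fin_cases i <;> fin_cases j <;>
      simp [Finset.sum_filter, Fin.sum_univ_four, Fin.sum_univ_three, Fin.succAbove, Fin.lt_def,
        cable_t, cableGen, pentHom_t, pentGen]
  | lie p q hp hq => simp only [LieHom.map_lie, PentExt.lt_lie, hp, hq]
  | add p q hp hq => simp only [map_add, PentExt.lt_add, hp, hq]
  | smul c p hp => simp only [map_smul, PentExt.lt_smul, hp]
  | zero => simp

theorem pentHom_brun {p : DK k 4} (hp : p ∈ brun₂₂ k) :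
    (pentHom p).rt = 0 ∧ (pentHom p).lt = 0 := by
  rw [brun₂₂, LieSubmodule.mem_inf, LieHom.mem_ker, LieHom.mem_ker] at hp
  rw [← pentHom_cable_pr_rt, ← pentHom_cable_pr_lt, hp.1, hp.2]
  simp

/-- Brunnian elements land in the bimodule, which is an abelian ideal of the extension. -/
theorem pentHom_commutator {p : DK k 4}
    (hp : p ∈ (⁅brun₂₂ k, brun₂₂ k⁆ : LieIdeal k (DK k 4))) : pentHom p = 0 := by
  have hp' : p ∈ (⁅brun₂₂ k, brun₂₂ k⁆ : LieIdeal k (DK k 4)).toSubmodule := hp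
  rw [LieSubmodule.lieIdeal_oper_eq_linear_span'] at hp'
  clear hp
  induction hp' using Submodule.span_induction with
  | mem z hz =>
    obtain ⟨a, ha, b, hb, rfl⟩ := hz
    obtain ⟨h1, h2⟩ := pentHom_brun ha
    obtain ⟨h3, h4⟩ := pentHom_brun hb
    rw [LieHom.map_lie]
    ext <;> simp [PentExt.md_lie, h1, h2, h3, h4]
  | zero => exact map_zero _
  | add z w _ _ hz hw => rw [map_add, hz, hw, add_zero]
  | smul r z _ hz => rw [map_smul, hz, smul_zero]

theorem mem_commutator_iff {p : DK k 4} (hp : p ∈ brun₂₂ k) :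
    p ∈ (⁅brun₂₂ k, brun₂₂ k⁆ : LieIdeal k (DK k 4)) ↔ (pentHom p).md = 0 := by
  refine ⟨fun h => by rw [pentHom_commutator h]; rfl, fun h => ?_⟩
  obtain ⟨_, ⟨a, rfl⟩, q, hq, rfl⟩ := Submodule.mem_sup.mp (mem_brunSpan hp)
  rw [map_add, pentHom_commutator hq, pentHom_brunWord] at h
  have ha : a = 0 := by simpa using h
  rw [ha, map_zero, zero_add]
  exact hq

theorem pentKrv_eq_zero_iff {φ : L₂ k} (hφ : φ ∈ degreeGE k 2) :
    pentKrv φ hφ = 0 ↔ (pentHom (pentagon φ)).md = 0 := by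
  -- The derived ideal formed inside `brun₂₂` is identified with the bracket of ideals formed in
  -- `𝔱₄`.
  have h : (⁅(⊤ : LieIdeal k ↥(brun₂₂ k)), (⊤ : LieIdeal k ↥(brun₂₂ k))⁆ :
      LieIdeal k ↥(brun₂₂ k)) = LieIdeal.comap (brun₂₂ k).incl ⁅brun₂₂ k, brun₂₂ k⁆ := by
    rw [← LieIdeal.comap_bracket_incl_of_le (brun₂₂ k) le_rfl le_rfl, LieIdeal.comap_incl_self]
  rw [pentKrv, LieSubmodule.Quotient.mk_eq_zero', h, LieIdeal.mem_comap,
    ← mem_commutator_iff (pentagon_mem hφ)]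
  rfl

end Brunnian

/-! ### Cyclic derivatives and cyclic words -/

section CyclicDerivative

open FreeAlgebra (ι)

attribute [local instance 100] LieRing.ofAssociativeRing

variable {k : Type u} [Field k]

/-- The values of `turn` on words. -/
noncomputable def turnWord (i : Fin 2) : List (Fin 2) → Assoc k →ₗ[k] Assoc k
  | [] => 0
  | j :: w => (if j = i then LinearMap.mulLeft k (word k w) else 0)
      + turnWord i w ∘ₗ LinearMap.mulRight k (ι k j)

/-- The sum of `q r p` over all factorizations `w = p x_i q` of a word, as a function of the word
and of `r`. -/
noncomputable def turn (i : Fin 2) : Assoc k →ₗ[k] Assoc k →ₗ[k] Assoc k := onWords (turnWord i)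

@[simp] theorem turn_one (i : Fin 2) (r : Assoc k) : turn i 1 r = 0 := by
  have : turn i (1 : Assoc k) = 0 := onWords_word _ []
  rw [this, LinearMap.zero_apply]

theorem turn_gen_mul (i j : Fin 2) (a r : Assoc k) :
    turn i (ι k j * a) r = (if j = i then a * r else 0) + turn i a (r * ι k j) := by
  have h : turn i ∘ₗ LinearMap.mulLeft k (ι k j) = (if j = i then LinearMap.mul k (Assoc k) else 0)
      + (LinearMap.lcomp k (Assoc k) (LinearMap.mulRight k (ι k j))) ∘ₗ turn i := by
    apply linearMap_ext_word
    intro w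
    simp only [LinearMap.comp_apply, LinearMap.mulLeft_apply, LinearMap.add_apply]
    rw [← word_cons, turn, onWords_word, onWords_word, turnWord]
    congr 1
    split_ifs <;> rfl
  have := LinearMap.congr_fun (LinearMap.congr_fun h a) r
  simp only [LinearMap.comp_apply, LinearMap.mulLeft_apply, LinearMap.add_apply] at this
  rw [this]
  split_ifs <;> rfl

/-- The removed letter lies in `a` or in `b`; the other factor joins `r` on the side it occupies
cyclically. -/
theorem turn_mul (i : Fin 2) (a b r : Assoc k) :
    turn i (a * b) r = turn i a (b * r) + turn i b (r * a) := by
  induction a using assoc_induction generalizing r with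
  | one => simp
  | gen_mul j a ha =>
    rw [mul_assoc, turn_gen_mul, turn_gen_mul, ha]
    split_ifs <;> simp only [mul_assoc, add_assoc, zero_add]
  | add a a' ha ha' => simp only [add_mul, mul_add, map_add, LinearMap.add_apply, ha, ha']; abel
  | smul c a ha => simp only [smul_mul_assoc, mul_smul_comm, map_smul, LinearMap.smul_apply, ha,
    smul_add]

theorem turn_gen (i j : Fin 2) (r : Assoc k) : turn i (ι k j) r = if j = i then r else 0 := by
  simpa using turn_gen_mul i j 1 r

/-- The cyclic derivative: the sum of `q p` over all factorizations `w = p x_i q` of a word. -/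
noncomputable def cycDeriv (i : Fin 2) : Assoc k →ₗ[k] Assoc k :=
  LinearMap.applyₗ 1 ∘ₗ turn i

theorem cycDeriv_apply (i : Fin 2) (a : Assoc k) : cycDeriv i a = turn i a 1 := rfl

theorem cycDeriv_mul_comm (i : Fin 2) (a b : Assoc k) :
    cycDeriv i (a * b) = cycDeriv i (b * a) := by
  simp only [cycDeriv_apply, turn_mul, mul_one, one_mul, add_comm]

theorem cycDeriv_eq_of_cyc_eq (i : Fin 2) {a b : Assoc k} (h : cyc k a = cyc k b) :
    cycDeriv i a = cycDeriv i b := by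
  have h' := (Submodule.Quotient.eq _).mp h
  rw [← sub_eq_zero, ← map_sub]
  generalize a - b = c at h'
  induction h' using Submodule.span_induction with
  | mem z hz =>
    obtain ⟨a, b, rfl⟩ := hz
    rw [map_sub, cycDeriv_mul_comm, sub_self]
  | zero => exact map_zero _
  | add z w _ _ hz hw => rw [map_add, hz, hw, add_zero]
  | smul r z _ hz => rw [map_smul, hz, smul_zero]

/-- At `n = 0` the truncated exponent `n - 1` is harmless, as the coefficient vanishes. -/
theorem turn_pow (i : Fin 2) {c : Assoc k} {γ : k} (hc : ∀ r, turn i c r = γ • r) (n m : ℕ) :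
    turn i (c ^ n) (c ^ m) = (γ * n) • c ^ (n - 1 + m) := by
  induction n generalizing m with
  | zero => simp
  | succ n ih =>
    rw [pow_succ', turn_mul, hc, ← pow_succ, ih, ← pow_add, Nat.add_sub_cancel]
    cases n with
    | zero => simp
    | succ n =>
      rw [show n + 1 - 1 + (m + 1) = n + 1 + m by omega, ← add_smul]
      push_cast
      ring_nf

theorem cycDeriv_aeval (i : Fin 2) {c : Assoc k} {γ : k} (hc : ∀ r, turn i c r = γ • r)
    (f : Polynomial k) :
    cycDeriv i (Polynomial.aeval c f) = γ • Polynomial.aeval c (Polynomial.derivative f) := by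
  induction f using Polynomial.induction_on' with
  | add p q hp hq => simp only [map_add, hp, hq, smul_add]
  | monomial n a =>
    have := turn_pow i hc n 0
    rw [Polynomial.derivative_monomial, Polynomial.aeval_monomial, Polynomial.aeval_monomial,
      ← Algebra.smul_def, ← Algebra.smul_def, map_smul, cycDeriv_apply]
    rw [pow_zero, add_zero] at this
    rw [this, smul_smul, smul_smul]
    ring_nf

/-- The Euler operator: multiplication of a word by its length. -/
noncomputable def euler : Assoc k →ₗ[k] Assoc k := onWords fun w => (w.length : k) • word k w

/-- Division of a word by its length. -/
noncomputable def eulerInv : Assoc k →ₗ[k] Assoc k :=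
  onWords fun w => (w.length : k)⁻¹ • word k w

theorem cyc_mul_comm (a b : Assoc k) : cyc k (a * b) = cyc k (b * a) := by
  rw [← sub_eq_zero, ← map_sub]
  exact (Submodule.Quotient.mk_eq_zero _).mpr (Submodule.subset_span ⟨a, b, rfl⟩)

/-- For `w = p x_i q` the term `x_i q r p` is a rotation of `w r`, and there is one term per letter
of `w`. The factor `r` collects the letters already passed in the induction. -/
theorem cyc_sum_turn (w : List (Fin 2)) (r : Assoc k) :
    cyc k (∑ i, ι k i * turn i (word k w) r) = (w.length : k) • cyc k (word k w * r) := by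
  induction w generalizing r with
  | nil => simp
  | cons j w ih =>
    have h : ∑ i, ι k i * turn i (word k (j :: w)) r
        = word k (j :: w) * r + ∑ i, ι k i * turn i (word k w) (r * ι k j) := by
      simp only [word_cons, turn_gen_mul, mul_add, Finset.sum_add_distrib, mul_ite, mul_zero,
        Finset.sum_ite_eq, Finset.mem_univ, if_true, mul_assoc]
    rw [h, map_add, ih, ← mul_assoc, cyc_mul_comm (word k w * r), ← mul_assoc, ← word_cons,
      List.length_cons, Nat.cast_succ, add_smul, one_smul, add_comm]

theorem cyc_euler (a : Assoc k) : cyc k (euler a) = cyc k (∑ i, ι k i * cycDeriv i a) := by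
  have h : cyc k ∘ₗ euler
      = cyc k ∘ₗ ∑ i, LinearMap.mulLeft k (ι k i) ∘ₗ cycDeriv i := by
    apply linearMap_ext_word
    intro w
    have := cyc_sum_turn w (1 : Assoc k)
    rw [mul_one] at this
    simp only [LinearMap.comp_apply, LinearMap.sum_apply, LinearMap.mulLeft_apply, euler,
      onWords_word, map_smul]
    rw [← this]
    rfl
  have := LinearMap.congr_fun h a
  simpa only [LinearMap.comp_apply, LinearMap.sum_apply, LinearMap.mulLeft_apply] using this

/-- Commutators are spanned by differences `vw - wv` of words of equal length, so division by length
preserves their span. -/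
theorem cyc_eulerInv {a : Assoc k} (h : cyc k a = 0) : cyc k (eulerInv a) = 0 := by
  have key : ∀ a b : Assoc k, cyc k (eulerInv (a * b)) = cyc k (eulerInv (b * a)) := by
    intro a b
    have : (LinearMap.mul k (Assoc k)).compr₂ (cyc k ∘ₗ eulerInv)
        = (LinearMap.mul k (Assoc k)).flip.compr₂ (cyc k ∘ₗ eulerInv) := by
      apply linearMap_ext_word
      intro v
      apply linearMap_ext_word
      intro w
      simp only [LinearMap.compr₂_apply, LinearMap.comp_apply, LinearMap.mul_apply',
        LinearMap.flip_apply]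
      rw [← word_append, ← word_append, eulerInv, onWords_word, onWords_word, map_smul, map_smul,
        word_append, word_append, cyc_mul_comm, List.length_append, List.length_append, add_comm]
    exact LinearMap.congr_fun (LinearMap.congr_fun this a) b
  have h' := (Submodule.Quotient.mk_eq_zero _).mp h
  clear h
  induction h' using Submodule.span_induction with
  | mem z hz =>
    obtain ⟨a, b, rfl⟩ := hz
    rw [map_sub, map_sub, key, sub_self]
  | zero => simp
  | add z w _ _ hz hw => rw [map_add, map_add, hz, hw, add_zero]
  | smul r z _ hz => rw [map_smul, map_smul, hz, smul_zero]

theorem eulerInv_euler [CharZero k] (a : Assoc k) :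
    eulerInv (euler a) = a - algebraMap k _ (aug a) := by
  have h : eulerInv ∘ₗ euler
      = LinearMap.id - Algebra.linearMap k (Assoc k) ∘ₗ aug.toLinearMap := by
    apply linearMap_ext_word
    intro w
    simp only [LinearMap.comp_apply, LinearMap.sub_apply, LinearMap.id_apply, euler, eulerInv,
      onWords_word, map_smul, AlgHom.toLinearMap_apply, Algebra.linearMap_apply, aug_word]
    cases w with
    -- Here `0⁻¹ = 0`, which accounts for the lost constant term.
    | nil => simp
    | cons i w =>
      rw [smul_smul, mul_inv_cancel₀ (Nat.cast_ne_zero.mpr (by simp))]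
      simp
  exact LinearMap.congr_fun h a

/-- Euler's formula recovers length times the cyclic word from the cyclic derivatives; in
characteristic 0 the length can be divided out. -/
theorem cyc_eq_of_cycDeriv_eq_zero [CharZero k] {a : Assoc k} (h : ∀ i, cycDeriv i a = 0) :
    cyc k a = cyc k (algebraMap k _ (aug a)) := by
  have h1 : cyc k (euler a) = 0 := by simp [cyc_euler, h]
  have h2 := cyc_eulerInv h1
  rwa [eulerInv_euler, map_sub, sub_eq_zero] at h2

end CyclicDerivative

/-! ### Coefficients of words, and the cyclic derivatives of the divergence -/

section Coefficients

open FreeAlgebra (ι)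

attribute [local instance 100] LieRing.ofAssociativeRing

variable {k : Type u} [Field k]

/-- The coefficient of a word. -/
noncomputable def coeff (v : List (Fin 2)) : Assoc k →ₗ[k] k :=
  (FreeAlgebra.basisFreeMonoid k (Fin 2)).coord (FreeMonoid.ofList v)

theorem coeff_word (v w : List (Fin 2)) : coeff v (word k w) = if w = v then 1 else 0 := by
  have := basis_eq_word (k := k) (FreeMonoid.ofList w)
  rw [FreeMonoid.toList_ofList] at this
  rw [← this, coeff, Module.Basis.coord_apply, Module.Basis.repr_self]
  exact Finsupp.single_apply (M := k) (a := w) (a' := v)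

theorem ext_coeff {a b : Assoc k} (h : ∀ v, coeff v a = coeff v b) : a = b :=
  (FreeAlgebra.basisFreeMonoid k (Fin 2)).ext_elem fun v => h (FreeMonoid.toList v)

theorem coeff_cons (i : Fin 2) (v : List (Fin 2)) (a : Assoc k) :
    coeff (i :: v) a = coeff v (stripLeft k i a) := by
  have h : coeff (i :: v) = coeff v ∘ₗ stripLeft k i := by
    apply linearMap_ext_word
    intro w
    cases w with
    | nil => rw [LinearMap.comp_apply, coeff_word, word_nil, stripLeft_one]; simp
    | cons j w =>
      rw [LinearMap.comp_apply, coeff_word, word_cons, stripLeft_gen_mul]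
      by_cases hij : j = i <;> simp [hij, coeff_word]
  exact LinearMap.congr_fun h a

theorem coeff_nil (a : Assoc k) : coeff [] a = aug a := by
  have h : coeff [] = (aug (k := k)).toLinearMap := by
    apply linearMap_ext_word
    intro w
    rw [coeff_word, AlgHom.toLinearMap_apply, aug_word]
  exact LinearMap.congr_fun h a

theorem eq_sum_stripRight (a : Assoc k) :
    a = algebraMap k _ (aug a) + ∑ i, stripRight i a * ι k i := by
  induction a using assoc_induction with
  | one => simp
  | gen_mul j a ha =>
    nth_rw 1 [ha]
    simp only [stripRight_gen_mul, add_mul, Finset.sum_add_distrib, map_mul, aug_gen, zero_mul,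
      map_zero, zero_add, mul_add, Finset.mul_sum, mul_assoc, ite_mul, Finset.sum_ite_eq,
      Finset.mem_univ, if_true]
    rw [Algebra.commutes, add_comm]
  | add a b ha hb =>
    nth_rw 1 [ha, hb]
    simp only [map_add, add_mul, Finset.sum_add_distrib]
    abel
  | smul c a ha =>
    nth_rw 1 [ha]
    simp only [map_smul, smul_add, Finset.smul_sum, smul_mul_assoc, Algebra.algebraMap_eq_smul_one,
      smul_assoc]

theorem coeff_concat_mul_gen (i j : Fin 2) (v : List (Fin 2)) (a : Assoc k) :
    coeff (v ++ [i]) (a * ι k j) = if j = i then coeff v a else 0 := by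
  have h : coeff (v ++ [i]) ∘ₗ LinearMap.mulRight k (ι k j) = if j = i then coeff v else 0 := by
    apply linearMap_ext_word
    intro w
    have : word k w * ι k j = word k (w ++ [j]) := by rw [word_append]; simp
    rw [LinearMap.comp_apply, LinearMap.mulRight_apply, this, coeff_word]
    split_ifs <;> simp_all [coeff_word]
  have := LinearMap.congr_fun h a
  rw [LinearMap.comp_apply, LinearMap.mulRight_apply] at this
  rw [this]
  split_ifs <;> rfl

theorem coeff_concat (i : Fin 2) (v : List (Fin 2)) (a : Assoc k) :
    coeff (v ++ [i]) a = coeff v (stripRight i a) := by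
  have h1 : coeff (v ++ [i]) (1 : Assoc k) = 0 := by rw [← word_nil, coeff_word]; simp
  nth_rw 1 [eq_sum_stripRight a]
  fin_cases i <;> simp [coeff_concat_mul_gen, Algebra.algebraMap_eq_smul_one] <;> exact Or.inr h1

/-- The sum of `G q p` over all factorizations `v = q p`. -/
def splitSum : List (Fin 2) → (List (Fin 2) → List (Fin 2) → k) → k
  | [], G => G [] []
  | i :: v, G => G [] (i :: v) + splitSum v fun q p => G (i :: q) p

theorem splitSum_add (v : List (Fin 2)) (G H : List (Fin 2) → List (Fin 2) → k) :
    splitSum v (fun q p => G q p + H q p) = splitSum v G + splitSum v H := by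
  induction v generalizing G H with
  | nil => rfl
  | cons i v ih => simp only [splitSum, ih]; ring

theorem splitSum_mul (c : k) (v : List (Fin 2)) (G : List (Fin 2) → List (Fin 2) → k) :
    splitSum v (fun q p => c * G q p) = c * splitSum v G := by
  induction v generalizing G with
  | nil => rfl
  | cons i v ih => simp only [splitSum, ih]; ring

theorem splitSum_zero (v : List (Fin 2)) : splitSum v (fun _ _ => (0 : k)) = 0 := by
  simpa using splitSum_mul (0 : k) v fun _ _ => 0

theorem splitSum_eq_add_last (v : List (Fin 2)) (G : List (Fin 2) → List (Fin 2) → k) :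
    splitSum v G = G v [] + splitSum v fun q s => if s = [] then 0 else G q s := by
  induction v generalizing G with
  | nil => simp [splitSum]
  | cons i v ih => rw [splitSum, ih, splitSum]; simp only [reduceCtorEq, if_false]; ring

theorem splitSum_single (v a b : List (Fin 2)) :
    splitSum v (fun q s => if q = a ∧ s = b then (1 : k) else 0) = if v = a ++ b then 1 else 0 := by
  induction v generalizing a with
  | nil => simp [splitSum, eq_comm]
  | cons i v ih =>
    rw [splitSum]
    cases a with
    | nil => simp [splitSum_zero]
    | cons j a =>
      by_cases h : i = j
      · simp [h, ih]
      · simp [h, splitSum_zero]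

open Classical in
theorem coeff_turn (i : Fin 2) (v w r : List (Fin 2)) :
    coeff v (turn i (word k w) (word k r))
      = splitSum v fun q s => if ∃ p, s = r ++ p ∧ w = p ++ i :: q then 1 else 0 := by
  induction w generalizing r with
  | nil => simp [splitSum_zero]
  | cons j w ih =>
    have e : word k r * ι k j = word k (r ++ [j]) := by rw [word_append]; simp
    rw [word_cons, turn_gen_mul, map_add, e, ih]
    -- Either `p` is empty and the removed letter is `j` itself, or `p` starts with `j`, which then
    -- moves into the factor `r`.
    have h : ∀ q s : List (Fin 2),
        (if ∃ p, s = r ++ p ∧ j :: w = p ++ i :: q then (1 : k) else 0)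
          = (if j = i then 1 else 0) * (if q = w ∧ s = r then 1 else 0)
            + if ∃ p, s = r ++ [j] ++ p ∧ w = p ++ i :: q then 1 else 0 := by
      intro q s
      by_cases h1 : j = i ∧ q = w ∧ s = r
      · obtain ⟨rfl, rfl, rfl⟩ := h1
        have hn : ¬ ∃ p, s = s ++ [j] ++ p ∧ q = p ++ j :: q := by
          rintro ⟨p, hp, -⟩
          simp at hp
        rw [if_neg hn, if_pos ⟨[], by simp, by simp⟩]
        simp
      · have e1 : (if j = i then (1 : k) else 0) * (if q = w ∧ s = r then 1 else 0) = 0 := by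
          split_ifs <;> simp_all
        rw [e1, zero_add]
        congr 1
        apply propext
        constructor
        · rintro ⟨p, hp, hw⟩
          cases p with
          | nil => simp_all
          | cons l p =>
            simp only [List.cons_append, List.cons.injEq] at hw
            exact ⟨p, by simp [hp, hw.1], hw.2⟩
        · rintro ⟨p, hp, hw⟩
          exact ⟨j :: p, by simp [hp], by simp [hw]⟩
    simp only [h, splitSum_add, splitSum_mul, splitSum_single]
    congr 1
    split_ifs with h1 h2 h2
    · rw [← word_append, coeff_word, if_pos h2.symm, mul_one]
    · rw [← word_append, coeff_word, if_neg (Ne.symm h2), mul_zero]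
    · simp
    · simp

theorem coeff_cycDeriv (i : Fin 2) (v : List (Fin 2)) (a : Assoc k) :
    coeff v (cycDeriv i a) = splitSum v fun q p => coeff (p ++ i :: q) a := by
  classical
  have ha : a ∈ Submodule.span k (Set.range (word k)) := by rw [span_word]; exact Submodule.mem_top
  induction ha using Submodule.span_induction with
  | mem z hz =>
    obtain ⟨w, rfl⟩ := hz
    rw [cycDeriv_apply, ← word_nil, coeff_turn]
    simp [coeff_word]
  | zero => simp [splitSum_zero]
  | add z w _ _ hz hw => simp only [map_add, hz, hw, splitSum_add]
  | smul r z _ hz => simp only [map_smul, smul_eq_mul, hz, splitSum_mul]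

theorem aug_merge (a : Assoc k) : aug (merge a) = 0 := by
  induction a using assoc_induction with
  | one => simp
  | gen_mul i a _ => rw [merge_gen_mul, map_mul, aug_gen, zero_mul]
  | add a b ha hb => rw [map_add, map_add, ha, hb, add_zero]
  | smul c a ha => rw [map_smul, map_smul, ha, smul_zero]

theorem stripLeft_merge (i : Fin 2) (a : Assoc k) :
    stripLeft k i (merge a) = merge (stripLeft k i a) + stripLeft k i (stripLeft k i a) := by
  induction a using assoc_induction with
  | one => simp [stripLeft_one]
  | gen_mul j a _ =>
    rw [merge_gen_mul, stripLeft_gen_mul, stripLeft_gen_mul]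
    split_ifs with h
    · rw [h]
    · simp
  | add a b ha hb => simp only [map_add, ha, hb]; abel
  | smul c a ha => simp only [map_smul, ha, smul_add]

/-- The words that merge to `v` are obtained by doubling one letter of `v`. -/
theorem coeff_merge (v : List (Fin 2)) (a : Assoc k) :
    coeff v (merge a) = splitSum v fun q s =>
      match s with
      | [] => 0
      | i :: p => coeff (q ++ i :: i :: p) a := by
  induction v generalizing a with
  | nil => rw [coeff_nil, aug_merge]; rfl
  | cons i v ih =>
    rw [coeff_cons, stripLeft_merge, map_add, ih, splitSum, add_comm, ← coeff_cons, ← coeff_cons]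
    congr 1
    congr 1
    funext q s
    cases s with
    | nil => rfl
    | cons j p => exact (coeff_cons i _ a).symm

/-- If `∑ x_i a_i = ∑ a_i x_i`, then the cyclic derivatives of the divergence are given by merging
adjacent letters. -/
theorem cycDeriv_divergence {a : Fin 2 → Assoc k} (h : ∑ i, ι k i * a i = ∑ i, a i * ι k i)
    (j : Fin 2) : cycDeriv j (∑ i, ι k i * stripLeft k i (a i))
      = stripRight j (a j) + merge (a j) := by
  set c : List (Fin 2) → k := fun v => coeff v (∑ i, ι k i * a i) with hc
  have h1 : ∀ i v, coeff v (a i) = c (i :: v) := fun i v => by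
    fin_cases i <;> simp [hc, coeff_cons, stripLeft_gen_mul]
  have h2 : ∀ i v, coeff v (a i) = c (v ++ [i]) := fun i v => by
    fin_cases i <;> simp [hc, h, coeff_concat_mul_gen]
  -- The two expressions of the hypothesis read `a_i` off by its letter on the left or on the right,
  -- so one letter at a time may be rotated.
  have h3 : ∀ u v, c (u ++ v) = c (v ++ u) := by
    intro u
    induction u with
    | nil => simp
    | cons i u ih =>
      intro v
      rw [List.cons_append, ← h1, h2, List.append_assoc, ih]
      simp
  have h4 : ∀ i v, coeff (i :: v) (∑ i, ι k i * stripLeft k i (a i)) = c (i :: i :: v) := by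
    intro i v
    rw [← h1]
    fin_cases i <;> simp [coeff_cons, stripLeft_gen_mul]
  apply ext_coeff
  intro v
  rw [coeff_cycDeriv, map_add, coeff_merge, splitSum_eq_add_last, ← coeff_concat, h1,
    List.nil_append,
    h4]
  congr 1
  -- The factorization with empty `p`: `c(jjv) = c(jvj)` is the coefficient of `vj` in `a_j`, the
  -- `stripRight` term.
  · exact h3 [j] (j :: v)
  · congr 1
    funext q s
    cases s with
    | nil => rfl
    | cons i p =>
      simp only [reduceCtorEq, if_false, List.cons_append, h4, h1]
      -- The factorization `v = q i p`: rotating `iipjq` to `jqiip` gives the coefficient of `qiip`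
      -- in `a_j`, a `merge` term.
      simpa using h3 (i :: i :: p) (j :: q)

theorem X_mul_toPoly_stripLeft (i : Fin 2) (a : Assoc k) :
    toPoly i a = Polynomial.C (aug a) + Polynomial.X * toPoly i (stripLeft k i a) := by
  nth_rw 1 [eq_sum_stripLeft a]
  fin_cases i <;> simp

theorem toPoly_stripRight_mul_X (i : Fin 2) (a : Assoc k) :
    toPoly i a = Polynomial.C (aug a) + toPoly i (stripRight i a) * Polynomial.X := by
  nth_rw 1 [eq_sum_stripRight a]
  fin_cases i <;> simp

theorem divX_mul_X (p : Polynomial k) : (p * Polynomial.X).divX = p := by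
  ext n
  rw [Polynomial.coeff_divX, Polynomial.coeff_mul_X]

theorem toPoly_stripLeft (i : Fin 2) (a : Assoc k) :
    toPoly i (stripLeft k i a) = (toPoly i a).divX := by
  rw [X_mul_toPoly_stripLeft i a, mul_comm, Polynomial.divX_add, Polynomial.divX_C,
    divX_mul_X, zero_add]

theorem toPoly_stripRight (i : Fin 2) (a : Assoc k) :
    toPoly i (stripRight i a) = (toPoly i a).divX := by
  rw [toPoly_stripRight_mul_X i a, Polynomial.divX_add, Polynomial.divX_C,
    divX_mul_X, zero_add]

theorem coeff_zero_toPoly (i : Fin 2) (a : Assoc k) : (toPoly i a).coeff 0 = aug a := by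
  rw [X_mul_toPoly_stripLeft]
  simp

/-- The power `x_iⁿ` has `n - 1` adjacent pairs, the difference of the factors `n` and 1. Merging
never eliminates a letter, so the other words contribute nothing. -/
theorem toPoly_merge (i : Fin 2) (a : Assoc k) :
    toPoly i (merge a) = Polynomial.derivative (toPoly i a) - (toPoly i a).divX := by
  induction a using assoc_induction with
  | one => simp
  | gen_mul j a ha =>
    rw [merge_gen_mul, map_mul, map_mul, map_add, ha, toPoly_gen]
    split_ifs with h
    · subst h
      have hd := (toPoly j a).divX_mul_X_add
      rw [toPoly_stripLeft, Polynomial.derivative_mul, Polynomial.derivative_X,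
        mul_comm Polynomial.X (toPoly j a), divX_mul_X]
      ring
    · simp
  | add a b ha hb => simp only [map_add, ha, hb, Polynomial.divX_add]; ring
  | smul c a ha =>
    simp only [map_smul, ha, smul_sub]
    simp only [Polynomial.smul_eq_C_mul, Polynomial.divX_C_mul]

theorem stripLeft_eq_zero_of_commute {i j : Fin 2} (hij : i ≠ j) {a : Assoc k}
    (h : ι k i * a = a * ι k i) : stripLeft k j a = 0 := by
  have h1 := congrArg (stripLeft k j) h
  rw [stripLeft_gen_mul, stripLeft_mul, stripLeft_gen, if_neg hij, if_neg hij, smul_zero,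
    add_zero] at h1
  have h2 := congrArg (stripRight i) h1
  simpa [stripRight_mul, stripRight_gen] using h2.symm

/-- Only polynomials in a generator commute with this generator. -/
theorem eq_aeval_of_commute {i : Fin 2} {a : Assoc k} (h : ι k i * a = a * ι k i) :
    a = Polynomial.aeval (ι k i) (toPoly i a) := by
  apply ext_coeff
  intro v
  induction v generalizing a with
  | nil =>
    rw [coeff_nil, coeff_nil, ← coeff_zero_toPoly i, ← coeff_zero_toPoly i]
    congr 1
    rw [← Polynomial.aeval_algHom_apply, toPoly_gen, if_pos rfl, Polynomial.aeval_X_left_apply]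
  | cons j v ih =>
    rw [coeff_cons, coeff_cons]
    by_cases hij : i = j
    · subst hij
      have h1 : ∀ p : Polynomial k, stripLeft k i (Polynomial.aeval (ι k i) p)
          = Polynomial.aeval (ι k i) p.divX := by
        intro p
        conv_lhs => rw [← p.X_mul_divX_add]
        rw [map_add, map_mul, Polynomial.aeval_X, Polynomial.aeval_C, map_add, stripLeft_gen_mul,
          if_pos rfl, Algebra.algebraMap_eq_smul_one, map_smul, stripLeft_one, smul_zero, add_zero]
      rw [h1, ← toPoly_stripLeft]
      apply ih
      -- Writing `d` for `stripLeft k i a`, this gives `a = d x_i + ε(a)`; comparison with `a = ε(a)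
      -- + x_i d` shows that `d` again commutes with `x_i`.
      have h2 := congrArg (stripLeft k i) h
      rw [stripLeft_gen_mul, if_pos rfl, stripLeft_mul, stripLeft_gen, if_pos rfl] at h2
      have h3 := eq_sum_stripLeft a
      rw [Fintype.sum_eq_single i fun j hj => by
        rw [stripLeft_eq_zero_of_commute hj.symm h, mul_zero]] at h3
      rw [Algebra.algebraMap_eq_smul_one, add_comm] at h3
      exact add_right_cancel (h3.symm.trans h2)
    · rw [stripLeft_eq_zero_of_commute hij h, stripLeft_eq_zero_of_commute hij]
      have := congrArg (Polynomial.aeval (ι k i)) (mul_comm Polynomial.X (toPoly i a))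
      rwa [map_mul, map_mul, Polynomial.aeval_X] at this

end Coefficients

/-! ### Comparison of the divergence with the pentagon -/

section Main

open FreeAlgebra (ι)

attribute [local instance 100] LieRing.ofAssociativeRing

variable {k : Type u} [Field k]

/-- Setting one generator to 0 makes both arguments of `φ` multiples of `T`, and `φ` has no linear
part. -/
theorem toPoly_toAssoc_subst {φ : L₂ k} (hφ : φ ∈ degreeGE k 2) (i : Fin 2) :
    toPoly i (toAssoc k (subst (-X k - Y k) (Y k) φ)) = 0 := by
  let F : L₂ k →ₗ⁅k⁆ Polynomial k := (toPoly i).toLieHom.comp (toAssoc k)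
  have hF : F (subst (-X k - Y k) (Y k) φ) = subst (F (-X k - Y k)) (F (Y k)) φ := map_subst _ _ _ _
  have h1 : F (-X k - Y k) = (-1 : k) • (Polynomial.X : Polynomial k) := by
    change toPoly i (toAssoc k _) = _
    fin_cases i <;> simp
  have h2 : F (Y k) = (if 1 = i then 1 else 0 : k) • (Polynomial.X : Polynomial k) := by
    change toPoly i (toAssoc k _) = _
    fin_cases i <;> simp
  rw [h1, h2, subst_eq_zero _ _ _ hφ] at hF
  exact hF

/-- The part of `φ` linear in `y` is a combination of the `ad_xⁿ(y)`. Reading `xⁿ y` instead of `y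
xⁿ` costs the sign `(-1)ⁿ`, which the substitution of `-x` for `x` restores. -/
theorem toPoly_stripRight_subst {φ : L₂ k} (hφ : φ ∈ degreeGE k 2) :
    toPoly 0 (stripRight 1 (toAssoc k (subst (-X k - Y k) (Y k) φ))) = depthOne φ := by
  -- The correction comes from the `-y` in the image of `x`; it vanishes on brackets.
  have key : ∀ z : L₂ k, toPoly 0 (stripRight 1 (toAssoc k (subst (-X k - Y k) (Y k) z)))
      = depthOne z - Polynomial.C (coeffX z) := by
    intro z
    induction z using lie_induction with
    | gen i =>
      fin_cases i
      · change toPoly 0 (stripRight 1 (toAssoc k (subst (-X k - Y k) (Y k) (X k))))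
          = depthOne (X k) - Polynomial.C (coeffX (X k))
        simp [depthOne_X, stripRight_gen]
      · change toPoly 0 (stripRight 1 (toAssoc k (subst (-X k - Y k) (Y k) (Y k))))
          = depthOne (Y k) - Polynomial.C (coeffX (Y k))
        simp [depthOne_Y, stripRight_gen]
    | lie z w hz hw =>
      have hc : ∀ z : L₂ k, coeffX (subst (-X k - Y k) (Y k) z) = -coeffX z := by
        intro z
        induction z using lie_induction with
        | gen i =>
          fin_cases i
          · change coeffX (subst (-X k - Y k) (Y k) (X k)) = -coeffX (X k); simp
          · change coeffX (subst (-X k - Y k) (Y k) (Y k)) = -coeffX (Y k); simp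
        | lie z w _ _ => rw [LieHom.map_lie, coeffX_lie, coeffX_lie, neg_zero]
        | add z w hz hw => rw [map_add, map_add, map_add, hz, hw, neg_add]
        | smul c z hz => rw [map_smul, map_smul, map_smul, hz, smul_neg]
        | zero => simp
      rw [LieHom.map_lie, toAssoc_lie, map_sub, stripRight_mul, stripRight_mul, aug_toAssoc,
        aug_toAssoc, zero_smul, zero_smul, add_zero, add_zero, map_sub, map_mul, map_mul, hz, hw,
        toPoly_toAssoc, toPoly_toAssoc, depthOne_lie, coeffX_lie, hc, hc]
      simp only [Polynomial.smul_eq_C_mul, map_neg, map_zero]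
      ring
    | add z w hz hw => simp only [map_add, hz, hw]; ring
    | smul c z hz => simp only [map_smul, hz, Polynomial.smul_eq_C_mul, smul_eq_mul, map_mul]; ring
    | zero => simp
  rw [key, coeffX_eq_zero hφ, map_zero, sub_zero]

/-- The involution of `k⟨x, y⟩` that exchanges the generators. -/
noncomputable def swapAssoc : Assoc k →ₐ[k] Assoc k := FreeAlgebra.lift k ![ι k 1, ι k 0]

theorem swapAssoc_gen (i : Fin 2) : swapAssoc (ι k i) = ι k (1 - i) := by
  rw [swapAssoc, FreeAlgebra.lift_ι_apply]
  fin_cases i <;> rfl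

theorem aug_swapAssoc (a : Assoc k) : aug (swapAssoc a) = aug a := by
  induction a using assoc_induction with
  | one => simp
  | gen_mul i a _ => simp [swapAssoc_gen]
  | add a b ha hb => simp only [map_add, ha, hb]
  | smul c a ha => simp only [map_smul, ha]

theorem one_sub_eq_iff (i j : Fin 2) : 1 - j = 1 - i ↔ j = i := by revert i j; decide

theorem stripLeft_swapAssoc (i : Fin 2) (a : Assoc k) :
    stripLeft k (1 - i) (swapAssoc a) = swapAssoc (stripLeft k i a) := by
  induction a using assoc_induction with
  | one => simp [stripLeft_one]
  | gen_mul j a _ =>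
    rw [map_mul, swapAssoc_gen, stripLeft_gen_mul, stripLeft_gen_mul]
    simp only [one_sub_eq_iff]
    split_ifs <;> simp
  | add a b ha hb => simp only [map_add, ha, hb]
  | smul c a ha => simp only [map_smul, ha]

theorem stripRight_swapAssoc (i : Fin 2) (a : Assoc k) :
    stripRight (1 - i) (swapAssoc a) = swapAssoc (stripRight i a) := by
  induction a using assoc_induction with
  | one => simp
  | gen_mul j a ha =>
    rw [map_mul, swapAssoc_gen, stripRight_gen_mul, stripRight_gen_mul, ha, aug_swapAssoc]
    simp only [one_sub_eq_iff]
    split_ifs <;> simp [swapAssoc_gen]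
  | add a b ha hb => simp only [map_add, ha, hb]
  | smul c a ha => simp only [map_smul, ha]

theorem merge_swapAssoc (a : Assoc k) : merge (swapAssoc a) = swapAssoc (merge a) := by
  induction a using assoc_induction with
  | one => simp
  | gen_mul j a ha =>
    rw [map_mul, swapAssoc_gen, merge_gen_mul, merge_gen_mul, ha, stripLeft_swapAssoc, map_mul,
      map_add, swapAssoc_gen]
  | add a b ha hb => simp only [map_add, ha, hb]
  | smul c a ha => simp only [map_smul, ha]

theorem toAssoc_swap (z : L₂ k) : toAssoc k (swap z) = swapAssoc (toAssoc k z) := by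
  induction z using lie_induction with
  | gen i =>
    fin_cases i
    · change toAssoc k (swap (X k)) = swapAssoc (toAssoc k (X k))
      simp [swap, swapAssoc_gen]
    · change toAssoc k (swap (Y k)) = swapAssoc (toAssoc k (Y k))
      simp [swap, swapAssoc_gen]
  | lie z w hz hw => rw [LieHom.map_lie, toAssoc_lie, toAssoc_lie, hz, hw, map_sub, map_mul,
    map_mul]
  | add z w hz hw => simp only [map_add, hz, hw]
  | smul c z hz => simp only [map_smul, hz]
  | zero => simp

@[simp] theorem swap_X : swap (X k) = Y k := subst_X _ _

@[simp] theorem swap_Y : swap (Y k) = X k := subst_Y _ _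

theorem swap_swap (z : L₂ k) : swap (swap z) = z := by
  have h : (swap (k := k)).comp swap = LieHom.id := by
    apply FreeLieAlgebra.hom_ext
    intro i
    fin_cases i
    · change swap (swap (X k)) = X k; simp
    · change swap (swap (Y k)) = Y k; simp
  exact LieHom.congr_fun h z

theorem swap_subst (φ : L₂ k) :
    swap (subst (-X k - Y k) (Y k) φ) = subst (-X k - Y k) (X k) φ := by
  rw [map_subst, map_sub, map_neg, swap_X, swap_Y]
  congr 2
  abel

theorem swap_tangential {a b : L₂ k} (h : swap b = a) (z : L₂ k) :
    swap (tangential (a, b) (swap z)) = tangential (a, b) z := by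
  have h' : swap a = b := by rw [← h, swap_swap]
  induction z using lie_induction with
  | gen i =>
    fin_cases i
    · change swap (tangential (a, b) (swap (X k))) = tangential (a, b) (X k)
      rw [swap_X, tangential_X, tangential_Y, LieHom.map_lie, swap_Y, h]
    · change swap (tangential (a, b) (swap (Y k))) = tangential (a, b) (Y k)
      rw [swap_Y, tangential_X, tangential_Y, LieHom.map_lie, swap_X, h']
  | lie z w hz hw =>
    rw [LieHom.map_lie, LieDerivation.apply_lie_eq_add, LieDerivation.apply_lie_eq_add, map_add,
      LieHom.map_lie, LieHom.map_lie, hz, hw, swap_swap, swap_swap]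
  | add z w hz hw => simp only [map_add, hz, hw]
  | smul c z hz => simp only [map_smul, hz]
  | zero => simp

theorem divergence_apply (a b : L₂ k) : divergence k (a, b)
    = cyc k (∑ i, ι k i * stripLeft k i (toAssoc k (![a, b] i))) := by
  rw [Fin.sum_univ_two]
  rfl

theorem mem_boundaryWords {c : CyclicWords k} : c ∈ boundaryWords k ↔
    ∃ f₀ f₁ f₂ : Polynomial k, c = cyc k (Polynomial.aeval (ι k 0) f₀ + Polynomial.aeval (ι k 1) f₁
      + Polynomial.aeval (-ι k 0 - ι k 1) f₂) := by
  constructor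
  · intro h
    rw [boundaryWords] at h
    obtain ⟨c', h', _, ⟨f₂, rfl⟩, rfl⟩ := Submodule.mem_sup.mp h
    obtain ⟨_, ⟨f₀, rfl⟩, _, ⟨f₁, rfl⟩, rfl⟩ := Submodule.mem_sup.mp h'
    exact ⟨f₀, f₁, f₂, by rw [map_add, map_add]; rfl⟩
  · rintro ⟨f₀, f₁, f₂, rfl⟩
    rw [map_add, map_add]
    exact add_mem (Submodule.mem_sup_left (add_mem (Submodule.mem_sup_left ⟨f₀, rfl⟩)
      (Submodule.mem_sup_right ⟨f₁, rfl⟩))) (Submodule.mem_sup_right ⟨f₂, rfl⟩)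

theorem cyc_gen_mul_stripLeft_mem {z : L₂ k} {i : Fin 2} (h : ⁅FreeLieAlgebra.of k i, z⁆ = 0) :
    cyc k (ι k i * stripLeft k i (toAssoc k z)) ∈ boundaryWords k := by
  have h1 : ι k i * toAssoc k z = toAssoc k z * ι k i := by
    have := congrArg (toAssoc k) h
    rwa [toAssoc_lie, toAssoc_of, map_zero, sub_eq_zero] at this
  have h2 := eq_sum_stripLeft (toAssoc k z)
  rw [Fintype.sum_eq_single i fun j hj => by
    rw [stripLeft_eq_zero_of_commute hj.symm h1, mul_zero], aug_toAssoc, map_zero, zero_add] at h2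
  rw [← h2, eq_aeval_of_commute h1, mem_boundaryWords]
  fin_cases i
  · exact ⟨_, 0, 0, by simp; rfl⟩
  · exact ⟨0, _, 0, by simp; rfl⟩

/-- Two representatives of a tangential derivation differ by elements commuting with `x` and `y`
respectively. These are polynomials in the generator, so the divergence changes by boundary words
only. -/
theorem divergence_mem_of_tangential_eq {a b a' b' : L₂ k}
    (h : tangential (a, b) = tangential (a', b')) (h' : divergence k (a', b') ∈ boundaryWords k) :
    divergence k (a, b) ∈ boundaryWords k := by
  have hX : ⁅X k, a - a'⁆ = 0 := by
    rw [lie_sub, ← tangential_X a b, ← tangential_X a' b', h, sub_self]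
  have hY : ⁅Y k, b - b'⁆ = 0 := by
    rw [lie_sub, ← tangential_Y a b, ← tangential_Y a' b', h, sub_self]
  have e : divergence k (a, b) = divergence k (a', b') + divergence k (a - a', b - b') := by
    rw [← map_add]; simp
  rw [e]
  refine add_mem h' ?_
  rw [divergence_apply, Fin.sum_univ_two, map_add]
  exact add_mem (cyc_gen_mul_stripLeft_mem hX) (cyc_gen_mul_stripLeft_mem hY)

theorem exists_derivative_eq [CharZero k] (p : Polynomial k) :
    ∃ f : Polynomial k, Polynomial.derivative f = p := by
  induction p using Polynomial.induction_on' with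
  | add p q hp hq =>
    obtain ⟨f, rfl⟩ := hp
    obtain ⟨g, rfl⟩ := hq
    exact ⟨f + g, map_add _ _ _⟩
  | monomial n a =>
    refine ⟨Polynomial.monomial (n + 1) (a / (n + 1)), ?_⟩
    have : (n + 1 : k) ≠ 0 := Nat.cast_add_one_ne_zero n
    rw [Polynomial.derivative_monomial, Nat.add_sub_cancel, Nat.cast_succ, div_mul_cancel₀ _ this]

theorem aeval_comp_neg_X (c : Assoc k) (f : Polynomial k) :
    Polynomial.aeval c (f.comp (-Polynomial.X)) = Polynomial.aeval (-c) f := by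
  rw [Polynomial.aeval_comp, map_neg, Polynomial.aeval_X]

theorem cycDeriv_boundary (i : Fin 2) (f₀ f₁ f₂ : Polynomial k) :
    cycDeriv i (Polynomial.aeval (ι k 0) f₀ + Polynomial.aeval (ι k 1) f₁
      + Polynomial.aeval (-ι k 0 - ι k 1) f₂)
    = Polynomial.aeval (ι k i) (Polynomial.derivative (![f₀, f₁] i))
      - Polynomial.aeval (-ι k 0 - ι k 1) (Polynomial.derivative f₂) := by
  have h2 : ∀ r : Assoc k, turn i (-ι k 0 - ι k 1) r = (-1 : k) • r := by
    intro r
    rw [map_sub, map_neg, LinearMap.sub_apply, LinearMap.neg_apply, turn_gen, turn_gen]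
    fin_cases i <;> simp
  have h : ∀ j, ∀ r : Assoc k, turn i (ι k j) r = (if j = i then 1 else 0 : k) • r := by
    intro j r
    rw [turn_gen]
    split_ifs <;> simp
  rw [map_add, map_add, cycDeriv_aeval i h2, cycDeriv_aeval i (h 0), cycDeriv_aeval i (h 1)]
  fin_cases i <;> simp [sub_eq_add_neg]

theorem divergence_mem_iff [CharZero k] {φ : L₂ k} (hφ : φ ∈ degreeGE k 2)
    (h : ⁅X k, subst (-X k - Y k) (X k) φ⁆ + ⁅Y k, subst (-X k - Y k) (Y k) φ⁆ = 0) :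
    divergence k (subst (-X k - Y k) (X k) φ, subst (-X k - Y k) (Y k) φ) ∈ boundaryWords k ↔
      pentKrv φ hφ = 0 := by
  rw [pentKrv_eq_zero_iff, pentHom_pentagon_md hφ]
  set b := subst (-X k - Y k) (Y k) φ with hb
  rw [← swap_subst, ← hb] at h ⊢
  set B := stripRight 1 (toAssoc k b) + merge (toAssoc k b) with hB
  set F := depthOne φ with hF
  have hcyc : ∑ i, ι k i * toAssoc k (![swap b, b] i) = ∑ i, toAssoc k (![swap b,
    b] i) * ι k i := by
    have := congrArg (toAssoc k) h
    rw [map_add, toAssoc_lie, toAssoc_lie, map_zero, toAssoc_X, toAssoc_Y] at this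
    rw [Fin.sum_univ_two, Fin.sum_univ_two, ← sub_eq_zero, ← this]
    simp only [Matrix.cons_val_zero, Matrix.cons_val_one]
    abel
  have hdiv := cycDeriv_divergence hcyc
  have h1 : stripRight 1 (toAssoc k (![swap b, b] 1)) + merge (toAssoc k (![swap b,
    b] 1)) = B := rfl
  have h0 : stripRight 0 (toAssoc k (![swap b, b] 0)) + merge (toAssoc k (![swap b, b] 0))
      = swapAssoc B := by
    change stripRight (1 - 1) (toAssoc k (swap b)) + merge (toAssoc k (swap b)) = _
    rw [toAssoc_swap, stripRight_swapAssoc, merge_swapAssoc, hB, map_add]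
  have hB0 : toPoly 0 B = F := by
    rw [hB, map_add, toPoly_stripRight_subst hφ, toPoly_merge, toPoly_toAssoc_subst hφ,
      map_zero, Polynomial.divX_zero, sub_zero, add_zero]
  have hB1 : toPoly 1 B = 0 := by
    rw [hB, map_add, toPoly_stripRight, toPoly_merge, toPoly_toAssoc_subst hφ]
    simp
  rw [divergence_apply, mem_boundaryWords]
  constructor
  · rintro ⟨f₀, f₁, f₂, hf⟩
    have e := cycDeriv_eq_of_cyc_eq 1 hf
    rw [hdiv 1, h1, cycDeriv_boundary] at e
    change B = Polynomial.aeval (ι k 1) (Polynomial.derivative f₁) - _ at e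
    set g := Polynomial.derivative f₁
    set g' := (Polynomial.derivative f₂).comp (-Polynomial.X) with hg'
    have e2 : Polynomial.aeval (-ι k 0 - ι k 1 : Assoc k) (Polynomial.derivative f₂)
        = Polynomial.aeval (ι k 0 + ι k 1 : Assoc k) g' := by
      rw [hg', aeval_comp_neg_X, neg_add']
    rw [e2] at e
    -- Now `B = g(y) - g'(x+y)`. Pure powers of `y` vanish in `B`, which forces `g = g'`; pure
    -- powers of `x` then give `F = g(0) - g`, and the constant `g(0)` cancels in `F(x+y) - F(y)`.
    have e3 := congrArg (toPoly 1) e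
    rw [hB1, map_sub, ← Polynomial.aeval_algHom_apply, ← Polynomial.aeval_algHom_apply, map_add,
      toPoly_gen, toPoly_gen, if_pos rfl, if_neg (by decide), zero_add,
      Polynomial.aeval_X_left_apply, Polynomial.aeval_X_left_apply] at e3
    have hg : g = g' := (sub_eq_zero.mp e3.symm)
    have e4 := congrArg (toPoly 0) e
    rw [hB0, map_sub, ← Polynomial.aeval_algHom_apply, ← Polynomial.aeval_algHom_apply, map_add,
      toPoly_gen, toPoly_gen, if_pos rfl, if_neg (by decide), add_zero,
      Polynomial.aeval_X_left_apply, ← hg] at e4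
    rw [e, e4, ← hg, map_sub, map_sub, ← Polynomial.coeff_zero_eq_aeval_zero',
      Polynomial.algebraMap_eq, Polynomial.aeval_C, Polynomial.aeval_C]
    abel
  · intro hp
    have hBF : B = Polynomial.aeval (ι k 0 + ι k 1 : Assoc k) F - Polynomial.aeval (ι k 1) F := by
      rw [← sub_eq_zero, ← hp]; abel
    -- The antiderivatives are chosen so that `f₁'(y) - f₂'(-x-y) = F(x+y) - F(y)`; by symmetry `f₁`
    -- also serves for `x`.
    obtain ⟨f₁, hf₁⟩ := exists_derivative_eq (-F)
    obtain ⟨f₂, hf₂⟩ := exists_derivative_eq (-F.comp (-Polynomial.X))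
    have hsw : swapAssoc B
      = Polynomial.aeval (ι k 0 + ι k 1 : Assoc k) F - Polynomial.aeval (ι k 0) F := by
      rw [hBF, map_sub, ← Polynomial.aeval_algHom_apply, ← Polynomial.aeval_algHom_apply, map_add,
        swapAssoc_gen, swapAssoc_gen, add_comm]
      rfl
    have hs : Polynomial.aeval (-ι k 0 - ι k 1 : Assoc k) (Polynomial.derivative f₂)
        = -Polynomial.aeval (ι k 0 + ι k 1 : Assoc k) F := by
      have hn : -(-ι k 0 - ι k 1 : Assoc k) = ι k 0 + ι k 1 := by abel
      rw [hf₂, map_neg, aeval_comp_neg_X, hn]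
    have hz := cyc_eq_of_cycDeriv_eq_zero (a := ∑ i, ι k i * stripLeft k i (toAssoc k (![swap b,
      b] i))
      - (Polynomial.aeval (ι k 0) f₁ + Polynomial.aeval (ι k 1) f₁
        + Polynomial.aeval (-ι k 0 - ι k 1 : Assoc k) f₂)) (by
      intro i
      rw [map_sub, hdiv, cycDeriv_boundary, hs]
      fin_cases i
      · change (stripRight 0 (toAssoc k (![swap b, b] 0)) + merge (toAssoc k (![swap b, b] 0)))
          - (Polynomial.aeval (ι k 0) (Polynomial.derivative f₁) - _) = 0
        rw [h0, hsw, hf₁, map_neg]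
        abel
      · change B - (Polynomial.aeval (ι k 1) (Polynomial.derivative f₁) - _) = 0
        rw [hBF, hf₁, map_neg]
        abel)
    generalize aug (k := k) _ = c at hz
    -- Equal cyclic derivatives leave a constant `c` undetermined; it is absorbed into `f₀`.
    refine ⟨f₁ + Polynomial.C c, f₁, f₂, ?_⟩
    rw [map_sub, sub_eq_iff_eq_add] at hz
    rw [hz, ← map_add, map_add (Polynomial.aeval _), Polynomial.aeval_C]
    congr 1
    abel

end Main

end KashiwaraVergne

open KashiwaraVergne
theorem mainTheorem3 {k : Type*} [Field k] [CharZero k] (φ : L₂ k) (hφ : φ ∈ degreeGE k 3) :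
    tangential (subst (-X k - Y k) (X k) φ, subst (-X k - Y k) (Y k) φ) ∈ krvSym k ↔
      (⁅X k, subst (-X k - Y k) (X k) φ⁆ + ⁅Y k, subst (-X k - Y k) (Y k) φ⁆ = 0 ∧
        pentKrv φ (degreeGE_anti (show 2 ≤ 3 by norm_num) hφ) = 0) := by
  have hφ2 := degreeGE_anti (show 2 ≤ 3 by norm_num) hφ
  have hu : ∀ a b : L₂ k, tangential (a, b) (-X k - Y k) = -(⁅X k, a⁆ + ⁅Y k, b⁆) := fun a b => by
    rw [map_sub, map_neg, tangential_X, tangential_Y]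
    abel
  constructor
  · rintro ⟨⟨a, b, hab, h0, hdiv⟩, -⟩
    have h : ⁅X k, subst (-X k - Y k) (X k) φ⁆ + ⁅Y k, subst (-X k - Y k) (Y k) φ⁆ = 0 := by
      rwa [hu, neg_eq_zero] at h0
    exact ⟨h, (divergence_mem_iff hφ2 h).mp (divergence_mem_of_tangential_eq hab hdiv)⟩
  · rintro ⟨h, hp⟩
    exact ⟨⟨_, _, rfl, by rw [hu, h, neg_zero], (divergence_mem_iff hφ2 h).mpr hp⟩,
      swap_tangential (swap_subst φ)⟩
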